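/- For an integer $k\ge 0$ let $H_k=\sum_{j=1}^k 1/j$, let $B_n$ and $B_n(x)$ be the Bernoulli numbers and polynomials ($B_1=-\tfrac12$), and put $\varphi_k(x)=\frac{1}{k+1}\bigl(B_{k+1}(x)-B_{k+1}\bigr)$. Let $L_k$ (the logarithm of the $k$-th generalised Glaisher--Kinkelin--Bendersky constant) be the constant term in the asymptotic behaviour of $\sum_{m=1}^{w}m^k\log m$ as the integer $w\to\infty$: the number $c$ for which there are real polynomials $P,Q$ with $Q(0)=0$ and $$\sum_{m=1}^{w}m^k\log m-P(w)\log w-Q(w)\longrightarrow c .$$ Put $I_0(x)=\log\Gamma(x+1)$, $I_k(x)=\int_0^x I_{k-1}(t)\,dt$, $\psi_k(x)=\sum_{r=0}^{k-1}\binom kr L_r x^{k-r}$, and define Bendersky's generalised gamma function $\Gamma_k$ for real $x>-1$ by the general solution $$\log\Gamma_k(x+1)=k!\,I_k(x)+H_k\,\varphi_k(x+1)-\psi_k(x).$$ Then the following hold. (a) For every $k\ge0$ the constant $L_k$ exists and is unique; moreover $\log\Gamma_k(w+1)=\sum_{m=1}^{w}m^k\log m$ for all integers $k,w\ge 0$ (in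 particular $\log\Gamma_k(2)=0$), and Adamchik's formula $\zeta'(-k)=\frac{H_kB_{k+1}}{k+1}-L_k$ holds for all $k\ge0$, where $\zeta$ is the Riemann zeta function. (b) For every integer $k\ge1$ (the integral being of an integrable function) $$\begin{aligned} k\int_0^1(1-t)^{k-1}\log\Gamma(t+1)\,dt&=\sum_{r=0}^{k-1}\binom kr L_r-H_k\,\varphi_k(2)\\ &=\sum_{r=0}^{k-1}\binom kr L_r-H_k\Bigl[\frac12+\frac1{k+1}\Bigl(1+\sum_{r=2}^{k}\binom{k+1}rB_r\Bigr)\Bigr]\\ &=\sum_{r=0}^{k-1}\binom kr\Bigl(\frac{H_rB_{r+1}}{r+1}-\zeta'(-r)\Bigr)-H_k\Bigl[\frac12+\frac1{k+1}\Bigl(1+\sum_{r=2}^{k}\binom{k+1}rB_r\Bigr)\Bigr]. \end{aligned}$$ (c) The function $(1-t)\log\Gamma(t)$ is integrable on $(0,1)$ and $$2\int_0^1(1-t)\log\Gamma(t)\,dt=-\zeta'(0)-2\zeta'(-1)+\frac16 .$$ -/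

import Mathlib

/-- `c` is the constant (that is, `w`-independent) term in the asymptotic behaviour of
`∑_{m=1}^w m ^ k * log m` as the integer `w` tends to infinity: after subtracting terms
`w ^ i * log w` (`i ≥ 0`) and `w ^ j` (`j ≥ 1`) with constant coefficients, the limit is `c`. -/
def IsGKBConstant (k : ℕ) (c : ℝ) : Prop :=
  ∃ P Q : Polynomial ℝ, Q.coeff 0 = 0 ∧
    Filter.Tendsto
      (fun w : ℕ => (∑ m ∈ Finset.Icc 1 w, (m : ℝ) ^ k * Real.log (m : ℝ))
        - (P.eval (w : ℝ) * Real.log (w : ℝ) + Q.eval (w : ℝ)))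
      Filter.atTop (nhds c)

/-- The constant `L_k = log A_k`, with `A_k` the generalised Glaisher-Kinkelin-Bendersky
constant. -/
noncomputable def gkbL (k : ℕ) : ℝ := Classical.epsilon (IsGKBConstant k)

/-- `φ_n(x) = (B_{n+1}(x) - B_{n+1}) / (n + 1)`. -/
noncomputable def bernoulliPhi (n : ℕ) (x : ℝ) : ℝ :=
  (Polynomial.aeval x (Polynomial.bernoulli (n + 1)) - (bernoulli (n + 1) : ℝ)) / ((n : ℝ) + 1)

/-- The nested integrals `I_0(x) = log Γ(x + 1)`, `I_k(x) = ∫_0^x I_{k-1}(t) dt`. -/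
noncomputable def nestedLogGamma : ℕ → ℝ → ℝ
  | 0, x => Real.log (Real.Gamma (x + 1))
  | k + 1, x => ∫ t in (0 : ℝ)..x, nestedLogGamma k t

/-- `ψ_k(x) = ∑_{r=0}^{k-1} C(k,r) L_r x^{k-r}`. -/
noncomputable def gkbPsi (k : ℕ) (x : ℝ) : ℝ :=
  ∑ r ∈ Finset.range k, (k.choose r : ℝ) * gkbL r * x ^ (k - r)

/-- Bendersky's general solution, which for real `x > -1` is the definition of
`log Γ_k(x + 1)`: `benderskyLogGamma k x` is
`k! I_k(x) + H_k φ_k(x + 1) - ψ_k(x)`. -/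
noncomputable def benderskyLogGamma (k : ℕ) (x : ℝ) : ℝ :=
  (k.factorial : ℝ) * nestedLogGamma k x + (harmonic k : ℝ) * bernoulliPhi k (x + 1)
    - gkbPsi k x

/-! Everything rests on the Euler-Maclaurin formula on one unit interval, used twice.

Applied to `t ^ (-s)`, it gives entire approximants of `(s - 1) ζ(s)` that converge uniformly on a
region containing both `-n` and points with `1 < re s`. Derivatives therefore converge at `-n`.
There the approximants reproduce `∑ m ^ n log m` minus its Euler-Maclaurin expansion, up to
`O(1/w)`. This expansion has the form `P(w) log w + Q(w)` plus the constant `H_n B_{n+1}/(n+1)`, so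
existence of `L_n` and Adamchik's formula come together (`exists_tendsto_powMulLogRemainder`).
Uniqueness of `L_n` holds because powers of `w` and powers times `log w` have different orders of
growth.

Write `G_n` for `benderskyLogGamma n`. The functional equation `G_n(x+1) = G_n(x) + (x+1)^n
log(x+1)` is proved by induction on `n`. Since `G_{n+1}' = (n+1) G_n + polynomial`, the equation at
level `n` gives the one at level `n+1` up to a constant, and that constant is `G_{n+1}(1)`. Its
vanishing amounts to the value of `∫_0^1 G_n`, a Raabe formula. This comes from Euler-Maclaurin
applied to `G_n` on `[w, w+1]`, whose remainder tends to zero because the digamma function varies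
little there.

Finally `G_k(1) = 0` is itself the integral formula: integrating by parts turns `k! I_k(1)` into `k
∫ (1-t)^(k-1) log Γ(t+1)`, and `φ_k(2) = 1`. -/

/-! ### Euler-Maclaurin on the unit interval. -/

theorem hasDerivAt_bernoulliFun_succ_div_factorial (n : ℕ) (x : ℝ) :
    HasDerivAt (fun t => bernoulliFun (n + 1) t / ((n + 1).factorial : ℝ))
      (bernoulliFun n x / (n.factorial : ℝ)) x := by
  have h := (hasDerivAt_bernoulliFun (n + 1) x).div_const ((n + 1).factorial : ℝ)
  convert! h using 1
  have := Nat.factorial_ne_zero n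
  rw [Nat.factorial_succ]
  push_cast
  field_simp

theorem bernoulliFun_one_eq_bernoulli' (n : ℕ) : bernoulliFun n 1 = (bernoulli' n : ℝ) := by
  rw [bernoulliFun, ← Polynomial.bernoulli_eval_one n]
  simpa using Polynomial.eval_map_apply (f := algebraMap ℚ ℝ) (p := Polynomial.bernoulli n) (x := 1)

/-- The Euler-Maclaurin formula on the unit interval. -/
theorem integral_eq_sub_sum_bernoulli'_smul {E : Type*} [NormedAddCommGroup E] [NormedSpace ℝ E]
    [CompleteSpace E] (g : ℕ → ℝ → E) (M : ℕ)
    (hg : ∀ j ≤ M, ∀ t ∈ Set.Icc (0 : ℝ) 1, HasDerivAt (g j) (g (j + 1) t) t)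
    (hi : IntervalIntegrable (g (M + 1)) MeasureTheory.volume 0 1) :
    ∫ t in (0 : ℝ)..1, g 0 t = g 0 1
      - ∑ j ∈ Finset.range (M + 1),
          ((bernoulli' (j + 1) : ℝ) / ((j + 1).factorial : ℝ)) • (g j 1 - g j 0)
      + (-1 : ℝ) ^ (M + 1) •
          ∫ t in (0 : ℝ)..1, (bernoulliFun (M + 1) t / ((M + 1).factorial : ℝ)) • g (M + 1) t := by
  have key : ∀ k, (∀ t ∈ Set.Icc (0 : ℝ) 1, HasDerivAt (g k) (g (k + 1) t) t) →
      IntervalIntegrable (g (k + 1)) MeasureTheory.volume 0 1 →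
      ∫ t in (0 : ℝ)..1, (bernoulliFun (k + 1) t / ((k + 1).factorial : ℝ)) • g (k + 1) t
        = (bernoulliFun (k + 1) 1 / ((k + 1).factorial : ℝ)) • g k 1
          - (bernoulliFun (k + 1) 0 / ((k + 1).factorial : ℝ)) • g k 0
          - ∫ t in (0 : ℝ)..1, (bernoulliFun k t / (k.factorial : ℝ)) • g k t := by
    intro k hk hik
    refine intervalIntegral.integral_smul_deriv_eq_deriv_smul
      (fun x _ => hasDerivAt_bernoulliFun_succ_div_factorial k x) ?_ ?_ hik
    · simpa [Set.uIcc_of_le] using hk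
    · exact ((continuous_bernoulliFun k).div_const _).intervalIntegrable _ _
  induction M with
  | zero =>
    have h := key 0 (hg 0 le_rfl) hi
    simp only [bernoulliFun_zero, bernoulliFun_one, Nat.factorial, Nat.cast_one, div_one,
      one_smul, zero_add] at h ⊢
    simp only [Nat.cast_one, div_one, mul_one] at h
    have h' : ∫ t in (0 : ℝ)..1, g 0 t = ((1 : ℝ) - 1 / 2) • g 0 1 - ((0 : ℝ) - 1 / 2) • g 0 0
        - ∫ t in (0 : ℝ)..1, (t - 1 / 2) • g 1 t := by rw [h]; abel
    rw [h']
    simp [bernoulli'_one]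
    module
  | succ M ih =>
    have hc : IntervalIntegrable (g (M + 1)) MeasureTheory.volume 0 1 := by
      refine ContinuousOn.intervalIntegrable fun t ht => ?_
      rw [Set.uIcc_of_le zero_le_one] at ht
      exact (hg (M + 1) le_rfl t ht).continuousAt.continuousWithinAt
    rw [ih (fun j hj => hg j (hj.trans (Nat.le_succ M))) hc, Finset.sum_range_succ _ (M + 1)]
    have h := key (M + 1) (hg _ le_rfl) hi
    have h' := sub_eq_iff_eq_add.mp h.symm
    rw [bernoulliFun_endpoints_eq_of_ne_one (by omega), ← bernoulliFun_endpoints_eq_of_ne_one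
      (by omega), bernoulliFun_one_eq_bernoulli'] at h'
    -- Odd Bernoulli numbers of index at least 2 vanish, so the alternating sign from repeated
    -- integration by parts can be dropped in the boundary terms.
    have hb : (-1 : ℝ) ^ (M + 2) * (bernoulli' (M + 2) : ℝ) = (bernoulli' (M + 2) : ℝ) := by
      have h1 := bernoulli_eq_bernoulli'_of_ne_one (n := M + 2) (by omega)
      rw [bernoulli] at h1
      exact_mod_cast h1
    rw [show ∫ t in (0 : ℝ)..1, (bernoulliFun (M + 1) t / ((M + 1).factorial : ℝ)) • g (M + 1) t
      = ((bernoulli' (M + 2) : ℝ) / ((M + 2).factorial : ℝ)) • (g (M + 1) 1 - g (M + 1) 0)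
        - ∫ t in (0 : ℝ)..1, (bernoulliFun (M + 1 + 1) t / ((M + 1 + 1).factorial : ℝ)) •
          g (M + 1 + 1) t by rw [smul_sub, h']; abel]
    rw [smul_sub ((-1 : ℝ) ^ (M + 1)), smul_smul]
    have : (-1 : ℝ) ^ (M + 1) * ((bernoulli' (M + 2) : ℝ) / ((M + 2).factorial : ℝ))
      = - ((bernoulli' (M + 2) : ℝ) / ((M + 2).factorial : ℝ)) := by
      linear_combination (-(1 / ((M + 2).factorial : ℝ))) * hb
    rw [this, pow_succ (-1 : ℝ) (M + 1)]
    module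

/-! ### Entire approximants of `(s - 1) ζ(s)` and their convergence. -/

/-- The coefficient of `t ^ (-s - i)` in the `i`-th derivative of `t ^ (-s)`. -/
noncomputable def negCpowCoeff (i : ℕ) (s : ℂ) : ℂ := ∏ l ∈ Finset.range i, (-s - (l : ℂ))

theorem differentiable_negCpowCoeff (i : ℕ) : Differentiable ℂ (negCpowCoeff i) := by
  unfold negCpowCoeff
  fun_prop

theorem negCpowCoeff_succ (i : ℕ) (s : ℂ) :
    negCpowCoeff (i + 1) s = negCpowCoeff i s * (-s - (i : ℂ)) :=
  Finset.prod_range_succ _ _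

/-- The approximants to `(s - 1) * ζ(s)` provided by the Euler-Maclaurin formula. -/
noncomputable def zetaApprox (M w : ℕ) (s : ℂ) : ℂ :=
  (s - 1) * ((∑ m ∈ Finset.Icc 1 w, (m : ℂ) ^ (-s))
    - ∑ j ∈ Finset.range (M + 1), ((bernoulli' (j + 1) : ℂ) / ((j + 1).factorial : ℂ))
        * (negCpowCoeff j s * (w : ℂ) ^ (-s - (j : ℂ)))) + (w : ℂ) ^ (1 - s)

theorem differentiable_zetaApprox (M : ℕ) {w : ℕ} (hw : w ≠ 0) :
    Differentiable ℂ (zetaApprox M w) := by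
  have h : ∀ m : ℕ, m ≠ 0 → ∀ f : ℂ → ℂ, Differentiable ℂ f →
      Differentiable ℂ fun s => (m : ℂ) ^ f s := fun m hm f hf s =>
    (hf s).const_cpow (Or.inl (Nat.cast_ne_zero.mpr hm))
  have h1 := differentiable_negCpowCoeff
  unfold zetaApprox
  refine ((differentiable_id.sub_const 1).mul (Differentiable.sub ?_ ?_)).add
    (h w hw _ (by fun_prop))
  · refine Differentiable.fun_sum fun m hm => h m ?_ _ (by fun_prop)
    have := (Finset.mem_Icc.mp hm).1
    omega
  · refine Differentiable.fun_sum fun j _ => ?_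
    exact (differentiable_const _).mul ((h1 j).mul (h w hw _ (by fun_prop)))

theorem hasDerivAt_const_add_ofReal_cpow {w t : ℝ} (h : 0 < w + t) (r : ℂ) :
    HasDerivAt (fun x : ℝ => ((w + x : ℝ) : ℂ) ^ r) (r * ((w + t : ℝ) : ℂ) ^ (r - 1)) t := by
  have h1 : HasDerivAt (fun x : ℝ => ((w + x : ℝ) : ℂ)) 1 t := by
    simpa using ((hasDerivAt_id t).const_add w).ofReal_comp
  have h2 := (hasDerivAt_id (((w + t : ℝ) : ℂ))).cpow_const (c := r)
    (Complex.ofReal_mem_slitPlane.mpr h)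
  convert! HasDerivAt.comp t h2 h1 using 1
  simp

/-- Euler-Maclaurin for `t ↦ (w + t) ^ (-s)`: the boundary terms telescope in `w`, and the integral,
once multiplied by `s - 1`, is absorbed by the increment of `w ^ (1 - s)`. The factor `s - 1` also
removes the division at `s = 1`. -/
theorem zetaApprox_succ_sub (M : ℕ) {w : ℕ} (hw : w ≠ 0) (s : ℂ) :
    zetaApprox M (w + 1) s - zetaApprox M w s = -((s - 1) * ((-1 : ℝ) ^ (M + 1) •
      ∫ t in (0 : ℝ)..1, (bernoulliFun (M + 1) t / ((M + 1).factorial : ℝ)) •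
        (negCpowCoeff (M + 1) s * ((w + t : ℝ) : ℂ) ^ (-s - ((M + 1 : ℕ) : ℂ))))) := by
  have hpos : ∀ t ∈ Set.Icc (0 : ℝ) 1, 0 < (w : ℝ) + t := fun t ht => by
    have : (0 : ℝ) < w := by positivity
    linarith [ht.1]
  have hd : ∀ j : ℕ, ∀ t ∈ Set.Icc (0 : ℝ) 1,
      HasDerivAt (fun t : ℝ => negCpowCoeff j s * ((w + t : ℝ) : ℂ) ^ (-s - (j : ℂ)))
        (negCpowCoeff (j + 1) s * ((w + t : ℝ) : ℂ) ^ (-s - ((j + 1 : ℕ) : ℂ))) t := by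
    intro j t ht
    have h := (hasDerivAt_const_add_ofReal_cpow (hpos t ht) (-s - (j : ℂ))).const_mul
      (negCpowCoeff j s)
    convert! h using 1
    rw [negCpowCoeff_succ]
    push_cast
    rw [show -s - ((j : ℂ) + 1) = -s - j - 1 by ring]
    ring
  have hci : ∀ j : ℕ, IntervalIntegrable
      (fun t : ℝ => negCpowCoeff j s * ((w + t : ℝ) : ℂ) ^ (-s - (j : ℂ)))
      MeasureTheory.volume 0 1 := by
    intro j
    refine ContinuousOn.intervalIntegrable fun t ht => ?_
    rw [Set.uIcc_of_le zero_le_one] at ht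
    exact (hd j t ht).continuousAt.continuousWithinAt
  have hem := integral_eq_sub_sum_bernoulli'_smul
    (fun j (t : ℝ) => negCpowCoeff j s * ((w + t : ℝ) : ℂ) ^ (-s - (j : ℂ))) M
    (fun j _ => hd j) (hci _)
  have hint : (1 - s) * ∫ t in (0 : ℝ)..1, ((w + t : ℝ) : ℂ) ^ (-s)
      = ((w : ℂ) + 1) ^ (1 - s) - (w : ℂ) ^ (1 - s) := by
    rw [← intervalIntegral.integral_const_mul]
    have := intervalIntegral.integral_eq_sub_of_hasDerivAt (a := (0 : ℝ)) (b := 1)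
      (f := fun t : ℝ => ((w + t : ℝ) : ℂ) ^ (1 - s))
      (f' := fun t : ℝ => (1 - s) * ((w + t : ℝ) : ℂ) ^ (-s)) ?_ ?_
    · rw [this]; simp
    · intro t ht
      rw [Set.uIcc_of_le zero_le_one] at ht
      convert! hasDerivAt_const_add_ofReal_cpow (hpos t ht) (1 - s) using 3
      ring
    · have := (hci 0).const_mul (1 - s)
      simpa [negCpowCoeff] using this
  have h0 : (∫ t in (0 : ℝ)..1, negCpowCoeff 0 s * ((w + t : ℝ) : ℂ) ^ (-s - ((0 : ℕ) : ℂ)))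
      = ∫ t in (0 : ℝ)..1, ((w + t : ℝ) : ℂ) ^ (-s) := by simp [negCpowCoeff]
  rw [h0] at hem
  rw [hem] at hint
  have hsum : ∑ j ∈ Finset.range (M + 1),
      ((bernoulli' (j + 1) : ℝ) / ((j + 1).factorial : ℝ)) •
        (negCpowCoeff j s * ((w + 1 : ℝ) : ℂ) ^ (-s - (j : ℂ))
          - negCpowCoeff j s * ((w + 0 : ℝ) : ℂ) ^ (-s - (j : ℂ)))
      = (∑ j ∈ Finset.range (M + 1), ((bernoulli' (j + 1) : ℂ) / ((j + 1).factorial : ℂ))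
        * (negCpowCoeff j s * ((w + 1 : ℕ) : ℂ) ^ (-s - (j : ℂ))))
      - ∑ j ∈ Finset.range (M + 1), ((bernoulli' (j + 1) : ℂ) / ((j + 1).factorial : ℂ))
        * (negCpowCoeff j s * (w : ℂ) ^ (-s - (j : ℂ))) := by
    rw [← Finset.sum_sub_distrib]
    refine Finset.sum_congr rfl fun j _ => ?_
    rw [Complex.real_smul]
    push_cast
    rw [add_zero]
    ring
  rw [hsum] at hint
  simp only [zetaApprox, Finset.sum_Icc_succ_top (Nat.le_add_left 1 w)]
  simp only [negCpowCoeff, Finset.range_zero, Finset.prod_empty, one_mul, Nat.cast_zero,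
    sub_zero, Complex.ofReal_add, Complex.ofReal_natCast, Complex.ofReal_one,
    Nat.cast_add, Nat.cast_one] at hint ⊢
  linear_combination -hint

/-- The remainder integrand has size `(w + t) ^ (-re s - n - 2)`, and the half-plane makes this
exponent at most `-3/2`, which is summable. The radius `n + 3` lets the region contain both `-n` and
`2`. -/
theorem exists_norm_zetaApprox_succ_sub_le (n : ℕ) :
    ∃ C : ℝ, ∀ w : ℕ, w ≠ 0 → ∀ s : ℂ, ‖s‖ < n + 3 → -(n : ℝ) - 1 / 2 < s.re →
      ‖zetaApprox (n + 1) (w + 1) s - zetaApprox (n + 1) w s‖ ≤ C * (w : ℝ) ^ (-(3 / 2) : ℝ) := by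
  obtain ⟨A, hA⟩ := (isCompact_closedBall (0 : ℂ) (n + 3)).exists_bound_of_continuousOn
    (f := fun s => (s - 1) * negCpowCoeff (n + 2) s)
    ((continuous_id.sub continuous_const).mul
      (differentiable_negCpowCoeff _).continuous).continuousOn
  obtain ⟨B, hB⟩ := (isCompact_Icc (a := (0 : ℝ)) (b := 1)).exists_bound_of_continuousOn
    (f := fun t => bernoulliFun (n + 2) t / ((n + 2).factorial : ℝ))
    ((continuous_bernoulliFun _).div_const _).continuousOn
  have hB0 : 0 ≤ B := (norm_nonneg _).trans (hB 0 (by simp))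
  refine ⟨A * B, fun w hw s hs hre => ?_⟩
  have hw0 : (0 : ℝ) < w := by positivity
  have hA' := hA s (by simpa using hs.le)
  rw [zetaApprox_succ_sub _ hw]
  have hI : ‖∫ t in (0 : ℝ)..1, (bernoulliFun (n + 2) t / ((n + 2).factorial : ℝ)) •
        (negCpowCoeff (n + 2) s * ((w + t : ℝ) : ℂ) ^ (-s - ((n + 2 : ℕ) : ℂ)))‖
      ≤ (B * (‖negCpowCoeff (n + 2) s‖ * (w : ℝ) ^ (-(3 / 2) : ℝ))) * |1 - 0| := by
    refine intervalIntegral.norm_integral_le_of_norm_le_const fun t ht => ?_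
    rw [Set.uIoc_of_le zero_le_one] at ht
    have hwt : (0 : ℝ) < w + t := by linarith [ht.1]
    rw [norm_smul, norm_mul, Complex.norm_cpow_eq_rpow_re_of_pos hwt]
    have h1 : (1 : ℝ) ≤ w := by exact_mod_cast Nat.one_le_iff_ne_zero.mpr hw
    gcongr
    · exact hB t ⟨ht.1.le, ht.2⟩
    · calc ((w : ℝ) + t) ^ (-s - ((n + 2 : ℕ) : ℂ)).re ≤ ((w : ℝ) + t) ^ (-(3 / 2) : ℝ) := by
            refine Real.rpow_le_rpow_of_exponent_le (by linarith [ht.1]) ?_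
            simp
            linarith
        _ ≤ (w : ℝ) ^ (-(3 / 2) : ℝ) :=
            Real.rpow_le_rpow_of_nonpos hw0 (by linarith [ht.1]) (by norm_num)
  rw [norm_neg, norm_mul, norm_smul]
  calc _ ≤ ‖s - 1‖ * (1 * ((B * (‖negCpowCoeff (n + 2) s‖ * (w : ℝ) ^ (-(3 / 2) : ℝ)))
            * |1 - 0|)) := by
        gcongr
        simp
    _ = (‖(s - 1) * negCpowCoeff (n + 2) s‖ * B) * (w : ℝ) ^ (-(3 / 2) : ℝ) := by
        rw [norm_mul]; simp; ring
    _ ≤ _ := by gcongr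

theorem tendsto_natCast_cpow_of_re_neg {z : ℂ} (hz : z.re < 0) :
    Filter.Tendsto (fun w : ℕ => (w : ℂ) ^ z) Filter.atTop (nhds 0) := by
  rw [tendsto_zero_iff_norm_tendsto_zero]
  have h := (tendsto_rpow_neg_atTop (neg_pos.mpr hz)).comp tendsto_natCast_atTop_atTop
  refine h.congr' ?_
  filter_upwards [Filter.eventually_gt_atTop 0] with w hw
  rw [Complex.norm_natCast_cpow_of_pos hw]
  simp

theorem tendsto_zetaApprox_of_one_lt_re (M : ℕ) {s : ℂ} (hs : 1 < s.re) :
    Filter.Tendsto (fun w => zetaApprox M w s) Filter.atTop (nhds (riemannZeta₁ s)) := by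
  have hs1 : s ≠ 1 := by rintro rfl; simp at hs
  have hz : riemannZeta₁ s = (s - 1) * (riemannZeta s - ∑ j ∈ Finset.range (M + 1),
      ((bernoulli' (j + 1) : ℂ) / ((j + 1).factorial : ℂ)) * (negCpowCoeff j s * 0)) + 0 := by
    rw [riemannZeta_eq_inv_sub_mul hs1]
    simp [mul_inv_cancel_left₀ (sub_ne_zero.mpr hs1)]
  rw [hz]
  refine ((tendsto_const_nhds).mul (Filter.Tendsto.sub ?_ (tendsto_finsetSum _ fun j _ =>
    (((tendsto_natCast_cpow_of_re_neg ?_).const_mul _).const_mul _)))).add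
    (tendsto_natCast_cpow_of_re_neg ?_)
  · have hsum : Summable fun m : ℕ => (1 : ℂ) / ((m : ℂ) + 1) ^ s := by
      have := (summable_nat_add_iff 1).mpr (Complex.summable_one_div_nat_cpow.mpr hs)
      simpa using this
    have := hsum.hasSum.tendsto_sum_nat
    rw [← zeta_eq_tsum_one_div_nat_add_one_cpow hs] at this
    refine this.congr fun w => ?_
    rw [← Finset.Ico_add_one_right_eq_Icc, Finset.sum_Ico_eq_sum_range]
    refine Finset.sum_congr (by simp) fun i _ => ?_
    rw [Complex.cpow_neg, one_div]
    push_cast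
    rw [add_comm]
  · simp; have : (0 : ℝ) ≤ j := by positivity
    linarith
  · simpa using hs

/-- Summable increments give uniform convergence on the convex region `V`, so the limit is
holomorphic there. It agrees with `(s - 1) ζ(s)` near `2`, hence on `V` by the identity theorem, and
locally uniform convergence passes to derivatives. -/
theorem tendsto_deriv_zetaApprox (n : ℕ) :
    Filter.Tendsto (fun w => zetaApprox (n + 1) (w + 1) (-(n : ℂ))) Filter.atTop
      (nhds (riemannZeta₁ (-(n : ℂ)))) ∧
    Filter.Tendsto (fun w => deriv (zetaApprox (n + 1) (w + 1)) (-(n : ℂ))) Filter.atTop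
      (nhds (deriv riemannZeta₁ (-(n : ℂ)))) := by
  set V : Set ℂ := Metric.ball 0 (n + 3) ∩ {s | -(n : ℝ) - 1 / 2 < s.re} with hV
  have hVo : IsOpen V := Metric.isOpen_ball.inter (isOpen_lt continuous_const Complex.continuous_re)
  have hVc : Convex ℝ V := (convex_ball _ _).inter (convex_halfSpace_re_gt _)
  have hn : (-(n : ℂ)) ∈ V := by
    constructor
    · simp
    · simp
  have h2 : (2 : ℂ) ∈ V := by
    constructor
    · simp; linarith [(Nat.cast_nonneg n : (0 : ℝ) ≤ n)]
    · simp; linarith [(Nat.cast_nonneg n : (0 : ℝ) ≤ n)]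
  obtain ⟨C, hC⟩ := exists_norm_zetaApprox_succ_sub_le n
  have hsum : Summable fun i : ℕ => C * ((i + 1 : ℕ) : ℝ) ^ (-(3 / 2) : ℝ) :=
    ((summable_nat_add_iff 1).mpr (Real.summable_nat_rpow.mpr (by norm_num))).mul_left C
  have hu := tendstoUniformlyOn_tsum_nat (s := V) hsum
    (f := fun i s => zetaApprox (n + 1) (i + 1 + 1) s - zetaApprox (n + 1) (i + 1) s)
    fun i s hs => hC (i + 1) (Nat.succ_ne_zero i) s (by simpa using hs.1) hs.2
  set S : ℂ → ℂ := fun s =>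
    ∑' i : ℕ, (zetaApprox (n + 1) (i + 1 + 1) s - zetaApprox (n + 1) (i + 1) s)
  have hu' : TendstoUniformlyOn (fun w s => zetaApprox (n + 1) (w + 1) s)
      (fun s => S s + zetaApprox (n + 1) 1 s) Filter.atTop V := by
    have hc : TendstoUniformlyOn (fun (_ : ℕ) s => zetaApprox (n + 1) 1 s)
        (fun s => zetaApprox (n + 1) 1 s) Filter.atTop V :=
      fun u hu => Filter.Eventually.of_forall fun _ s _ => refl_mem_uniformity hu
    refine (hu.add hc).congr (Filter.Eventually.of_forall fun w s _ => ?_)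
    have h := Finset.sum_range_sub (fun i => zetaApprox (n + 1) (i + 1) s) w
    simp only [Pi.add_apply]
    rw [h]
    ring
  have hl := hu'.tendstoLocallyUniformlyOn
  have hdiff : ∀ᶠ w in Filter.atTop, DifferentiableOn ℂ (zetaApprox (n + 1) (w + 1)) V :=
    Filter.Eventually.of_forall fun w =>
      (differentiable_zetaApprox _ (Nat.succ_ne_zero w)).differentiableOn
  have hd := hl.differentiableOn hdiff hVo
  have heq : Set.EqOn (fun s => S s + zetaApprox (n + 1) 1 s) riemannZeta₁ V := by
    refine (hd.analyticOnNhd hVo).eqOn_of_preconnected_of_eventuallyEq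
      (differentiable_riemannZeta₁.differentiableOn.analyticOnNhd hVo) hVc.isPreconnected h2 ?_
    have hO : IsOpen (V ∩ {s : ℂ | 1 < s.re}) :=
      hVo.inter (isOpen_lt continuous_const Complex.continuous_re)
    filter_upwards [hO.mem_nhds ⟨h2, by simp⟩] with s hs
    exact tendsto_nhds_unique (hl.tendsto_at hs.1)
      ((tendsto_zetaApprox_of_one_lt_re (n + 1) hs.2).comp (Filter.tendsto_add_atTop_nat 1))
  have hl' := hl.congr_right heq
  exact ⟨hl'.tendsto_at hn, (hl'.deriv hdiff hVo).tendsto_at hn⟩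

/-! ### Differentiating the approximants at `-n`. -/

theorem negCpowCoeff_neg_natCast (n i : ℕ) :
    negCpowCoeff i (-(n : ℂ)) = (n.descFactorial i : ℂ) := by
  induction i with
  | zero => simp [negCpowCoeff]
  | succ i ih =>
    rw [negCpowCoeff_succ, ih, Nat.descFactorial_succ]
    rcases le_or_gt i n with h | h
    · push_cast [Nat.cast_sub h]; ring
    · simp [Nat.descFactorial_of_lt h]

/-- The logarithmic derivative of `∏ (-s - l)` at `-n` is `-∑_{l < i} 1/(n - l)`, a difference of
harmonic numbers. For `i ≤ n` no factor vanishes. -/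
theorem hasDerivAt_negCpowCoeff {n i : ℕ} (hi : i ≤ n) :
    HasDerivAt (negCpowCoeff i)
      (-((n.descFactorial i : ℂ) * ((harmonic n : ℂ) - (harmonic (n - i) : ℂ)))) (-(n : ℂ)) := by
  induction i with
  | zero =>
    have : negCpowCoeff 0 = fun _ => 1 := by ext; simp [negCpowCoeff]
    rw [this]
    simpa using hasDerivAt_const (-(n : ℂ)) (1 : ℂ)
  | succ i ih =>
    have h1 := (ih (by omega)).mul (((hasDerivAt_id (-(n : ℂ))).neg).sub_const (i : ℂ))
    have h2 : negCpowCoeff (i + 1) = negCpowCoeff i * fun s => -id s - (i : ℂ) := by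
      ext s; exact negCpowCoeff_succ i s
    rw [h2]
    convert! h1 using 1
    obtain ⟨k, rfl⟩ : ∃ k, n = i + 1 + k := ⟨n - (i + 1), by omega⟩
    rw [negCpowCoeff_neg_natCast, Nat.descFactorial_succ, show i + 1 + k - i = k + 1 by omega,
      show i + 1 + k - (i + 1) = k by omega, harmonic_succ]
    have : (k : ℂ) + 1 ≠ 0 := by exact_mod_cast Nat.succ_ne_zero k
    push_cast
    simp only [Pi.neg_apply, id]
    field_simp
    ring

/-- The `i`-th derivative of `t ^ n * log t`, for `i ≤ n`. -/
noncomputable def powMulLogDeriv (n i : ℕ) (t : ℝ) : ℝ :=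
  (n.descFactorial i : ℝ) * t ^ (n - i) *
    (Real.log t + ((harmonic n : ℝ) - (harmonic (n - i) : ℝ)))

/-- The antiderivative of `t ^ n * log t`. -/
noncomputable def powMulLogPrimitive (n : ℕ) (t : ℝ) : ℝ :=
  t ^ (n + 1) / ((n : ℝ) + 1) * (Real.log t - 1 / ((n : ℝ) + 1))

/-- The sum of `m ^ n * log m` minus its Euler-Maclaurin expansion. -/
noncomputable def powMulLogRemainder (n w : ℕ) : ℝ :=
  (∑ m ∈ Finset.Icc 1 w, (m : ℝ) ^ n * Real.log (m : ℝ)) - powMulLogPrimitive n w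
    - ∑ j ∈ Finset.range (n + 1), ((bernoulli' (j + 1) : ℝ) / ((j + 1).factorial : ℝ))
        * powMulLogDeriv n j w

/-- The left side is the derivative at `-n` of `zetaApprox (n + 1) w s / (s - 1)`. The term `j = n +
1` has a coefficient vanishing at `-n`, so only the derivative of that coefficient survives,
multiplied by `w⁻¹`; this is the error term with `c`. -/
theorem deriv_zetaApprox_neg_natCast (n : ℕ) :
    ∃ c : ℂ, ∀ w : ℕ, w ≠ 0 →
      -((-(n : ℂ) - 1)⁻¹) ^ 2 * zetaApprox (n + 1) w (-(n : ℂ))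
        + (-(n : ℂ) - 1)⁻¹ * deriv (zetaApprox (n + 1) w) (-(n : ℂ))
      = -(powMulLogRemainder n w : ℂ) - c * (w : ℂ)⁻¹ := by
  refine ⟨((bernoulli' (n + 2) : ℂ) / ((n + 2).factorial : ℂ)) *
    deriv (negCpowCoeff (n + 1)) (-(n : ℂ)), fun w hw => ?_⟩
  have hcpow : ∀ m : ℕ, m ≠ 0 → ∀ k : ℂ, HasDerivAt (fun s : ℂ => (m : ℂ) ^ (-s - k))
      (-((m : ℂ) ^ ((n : ℂ) - k) * (Real.log m : ℂ))) (-(n : ℂ)) := by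
    intro m hm k
    have h := (((hasDerivAt_id (-(n : ℂ))).neg).sub_const k).const_cpow (c := (m : ℂ))
      (Or.inl (Nat.cast_ne_zero.mpr hm))
    convert! h using 1
    simp [Complex.natCast_log]
  have hS : HasDerivAt (fun s : ℂ => ∑ m ∈ Finset.Icc 1 w, (m : ℂ) ^ (-s))
      (∑ m ∈ Finset.Icc 1 w, -((m : ℂ) ^ n * (Real.log m : ℂ))) (-(n : ℂ)) := by
    refine HasDerivAt.fun_sum fun m hm => ?_
    have := hcpow m (by have := (Finset.mem_Icc.mp hm).1; omega) 0
    simpa using this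
  have hT : HasDerivAt (fun s : ℂ => ∑ j ∈ Finset.range (n + 1 + 1),
      ((bernoulli' (j + 1) : ℂ) / ((j + 1).factorial : ℂ))
        * (negCpowCoeff j s * (w : ℂ) ^ (-s - (j : ℂ))))
      (∑ j ∈ Finset.range (n + 1 + 1), ((bernoulli' (j + 1) : ℂ) / ((j + 1).factorial : ℂ))
        * (deriv (negCpowCoeff j) (-(n : ℂ)) * (w : ℂ) ^ (- -(n : ℂ) - (j : ℂ))
          + negCpowCoeff j (-(n : ℂ)) * (-((w : ℂ) ^ ((n : ℂ) - j) * (Real.log w : ℂ)))))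
      (-(n : ℂ)) :=
    HasDerivAt.fun_sum fun j _ =>
      (((differentiable_negCpowCoeff j _).hasDerivAt).mul (hcpow w hw j)).const_mul _
  have hB : HasDerivAt (fun s : ℂ => (w : ℂ) ^ (1 - s))
      (-((w : ℂ) ^ (n + 1) * (Real.log w : ℂ))) (-(n : ℂ)) := by
    have := hcpow w hw (-1)
    convert! this using 1
    · ext s; congr 1; ring
    · rw [sub_neg_eq_add]; norm_cast
  have hZ := (((hasDerivAt_id (-(n : ℂ))).sub_const 1).mul (hS.sub hT)).add hB
  have hZ' : deriv (zetaApprox (n + 1) w) (-(n : ℂ)) = _ := hZ.deriv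
  rw [hZ']
  have hn : (n : ℂ) + 1 ≠ 0 := by exact_mod_cast Nat.succ_ne_zero n
  have hn' : -(n : ℂ) - 1 ≠ 0 := by
    rw [show -(n : ℂ) - 1 = -((n : ℂ) + 1) by ring]; exact neg_ne_zero.mpr hn
  have hw' : (w : ℂ) ≠ 0 := Nat.cast_ne_zero.mpr hw
  have hTe : (∑ j ∈ Finset.range (n + 1 + 1),
        ((bernoulli' (j + 1) : ℂ) / ((j + 1).factorial : ℂ))
        * (deriv (negCpowCoeff j) (-(n : ℂ)) * (w : ℂ) ^ (- -(n : ℂ) - (j : ℂ))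
          + negCpowCoeff j (-(n : ℂ)) * (-((w : ℂ) ^ ((n : ℂ) - j) * (Real.log w : ℂ)))))
      = -((∑ j ∈ Finset.range (n + 1), ((bernoulli' (j + 1) : ℝ) / ((j + 1).factorial : ℝ))
        * powMulLogDeriv n j w : ℝ) : ℂ) + ((bernoulli' (n + 2) : ℂ) / ((n + 2).factorial : ℂ)) *
    deriv (negCpowCoeff (n + 1)) (-(n : ℂ)) * (w : ℂ)⁻¹ := by
    rw [Finset.sum_range_succ]
    congr 1
    · rw [Complex.ofReal_sum, ← Finset.sum_neg_distrib]
      refine Finset.sum_congr rfl fun j hj => ?_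
      have hj' : j ≤ n := Nat.lt_succ_iff.mp (Finset.mem_range.mp hj)
      rw [(hasDerivAt_negCpowCoeff hj').deriv, negCpowCoeff_neg_natCast, neg_neg,
        ← Nat.cast_sub hj', Complex.cpow_natCast]
      simp only [powMulLogDeriv]
      push_cast
      ring
    · rw [negCpowCoeff_neg_natCast, Nat.descFactorial_of_lt (Nat.lt_succ_self n),
        show - -(n : ℂ) - ((n + 1 : ℕ) : ℂ) = -1 by push_cast; ring, Complex.cpow_neg_one]
      simp
      ring
  simp only [Pi.sub_apply, id]
  rw [hTe]
  have h1 : zetaApprox (n + 1) w (-(n : ℂ)) = (-(n : ℂ) - 1) *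
    ((∑ m ∈ Finset.Icc 1 w, (m : ℂ) ^ (- -(n : ℂ)))
    - ∑ j ∈ Finset.range (n + 1 + 1), ((bernoulli' (j + 1) : ℂ) / ((j + 1).factorial : ℂ))
        * (negCpowCoeff j (-(n : ℂ)) * (w : ℂ) ^ (- -(n : ℂ) - (j : ℂ)))) + (w : ℂ) ^ (n + 1) := by
    rw [zetaApprox, show (1 : ℂ) - -(n : ℂ) = ((n + 1 : ℕ) : ℂ) by push_cast; ring,
      Complex.cpow_natCast]
  rw [h1]
  generalize (∑ m ∈ Finset.Icc 1 w, (m : ℂ) ^ (- -(n : ℂ)))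
    - ∑ j ∈ Finset.range (n + 1 + 1), ((bernoulli' (j + 1) : ℂ) / ((j + 1).factorial : ℂ))
        * (negCpowCoeff j (-(n : ℂ)) * (w : ℂ) ^ (- -(n : ℂ) - (j : ℂ))) = A
  rw [powMulLogRemainder, powMulLogPrimitive, Finset.sum_neg_distrib]
  push_cast
  generalize (∑ j ∈ Finset.range (n + 1), ((bernoulli' (j + 1) : ℂ) / ((j + 1).factorial : ℂ))
        * (powMulLogDeriv n j w : ℂ)) = B
  generalize (∑ m ∈ Finset.Icc 1 w, (m : ℂ) ^ n * (Real.log m : ℂ)) = D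
  have e : (-(n : ℂ) - 1)⁻¹ = -((n : ℂ) + 1)⁻¹ := by
    rw [← inv_neg]; congr 1; ring
  rw [e]
  field_simp
  ring

theorem exists_tendsto_powMulLogRemainder (n : ℕ) :
    ∃ c : ℝ, Filter.Tendsto (powMulLogRemainder n) Filter.atTop (nhds c) ∧
      deriv riemannZeta (-(n : ℂ)) = -(c : ℂ) := by
  obtain ⟨h1, h2⟩ := tendsto_deriv_zetaApprox n
  obtain ⟨d, hd⟩ := deriv_zetaApprox_neg_natCast n
  have hn : (-(n : ℂ)) ≠ 1 := by
    intro h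
    have := congrArg Complex.re h
    simp at this
    linarith [(Nat.cast_nonneg n : (0 : ℝ) ≤ n)]
  have h3 := (h1.const_mul (-((-(n : ℂ) - 1)⁻¹) ^ 2)).add (h2.const_mul ((-(n : ℂ) - 1)⁻¹))
  rw [← deriv_riemannZeta_eq_neg_inv_sub_sq_mul_add hn] at h3
  have h4 : Filter.Tendsto (fun w : ℕ => d * ((w + 1 : ℕ) : ℂ)⁻¹) Filter.atTop (nhds 0) := by
    have := (tendsto_inv_atTop_nhds_zero_nat (𝕜 := ℂ)).comp (Filter.tendsto_add_atTop_nat 1)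
    simpa using this.const_mul d
  have h5 : Filter.Tendsto (fun w : ℕ => ((powMulLogRemainder n (w + 1) : ℝ) : ℂ)) Filter.atTop
      (nhds (-deriv riemannZeta (-(n : ℂ)))) := by
    have := (h3.add h4).neg
    rw [add_zero] at this
    refine this.congr fun w => ?_
    rw [hd (w + 1) (Nat.succ_ne_zero w)]
    ring
  have h6 := (Complex.continuous_re.tendsto _).comp h5
  have h7 : Filter.Tendsto (fun w : ℕ => powMulLogRemainder n (w + 1)) Filter.atTop
      (nhds (-deriv riemannZeta (-(n : ℂ))).re) := h6
  refine ⟨(-deriv riemannZeta (-(n : ℂ))).re, (Filter.tendsto_add_atTop_iff_nat 1).mp h7, ?_⟩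
  have h8 := tendsto_nhds_unique h5 ((Complex.continuous_ofReal.tendsto _).comp h7)
  rw [← h8, neg_neg]

/-! ### Uniqueness of the constant term. -/

theorem tendsto_eval_div_pow {P : Polynomial ℝ} {n : ℕ} (hP : P.natDegree ≤ n) :
    Filter.Tendsto (fun w : ℕ => P.eval (w : ℝ) / (w : ℝ) ^ n) Filter.atTop (nhds (P.coeff n)) := by
  have h : Filter.Tendsto (fun w : ℕ => ∑ i ∈ Finset.range (n + 1),
      P.coeff i * ((w : ℝ)⁻¹) ^ (n - i)) Filter.atTop
      (nhds (∑ i ∈ Finset.range (n + 1), P.coeff i * (0 : ℝ) ^ (n - i))) :=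
    tendsto_finsetSum _ fun i _ => (tendsto_inv_atTop_nhds_zero_nat.pow _).const_mul _
  have h0 : ∑ i ∈ Finset.range (n + 1), P.coeff i * (0 : ℝ) ^ (n - i) = P.coeff n := by
    rw [Finset.sum_range_succ, Finset.sum_eq_zero]
    · simp
    · intro i hi
      have : n - i ≠ 0 := by have := Finset.mem_range.mp hi; omega
      simp [this]
  rw [h0] at h
  refine h.congr' ?_
  filter_upwards [Filter.eventually_gt_atTop 0] with w hw
  have hw' : (w : ℝ) ≠ 0 := by positivity
  rw [Polynomial.eval_eq_sum_range' (Nat.lt_succ_of_le hP), Finset.sum_div]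
  refine Finset.sum_congr rfl fun i hi => ?_
  obtain ⟨k, rfl⟩ : ∃ k, n = i + k := ⟨n - i, by have := Finset.mem_range.mp hi; omega⟩
  rw [Nat.add_sub_cancel_left, pow_add, inv_pow]
  field_simp

theorem tendsto_log_natCast_atTop :
    Filter.Tendsto (fun w : ℕ => Real.log (w : ℝ)) Filter.atTop Filter.atTop :=
  Real.tendsto_log_atTop.comp tendsto_natCast_atTop_atTop

theorem natDegree_le_of_coeff_succ_eq_zero {P : Polynomial ℝ} {n : ℕ}
    (hP : P.natDegree ≤ n + 1) (h : P.coeff (n + 1) = 0) : P.natDegree ≤ n := by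
  rw [Polynomial.natDegree_le_iff_coeff_eq_zero] at hP ⊢
  intro N hN
  rcases Nat.lt_or_ge (n + 1) N with h' | h'
  · exact hP N h'
  · rwa [show N = n + 1 by omega]

/-- Descent on a common degree bound `n`. Dividing by `w ^ n log w` isolates the top coefficient of
`P`, which must be zero; then, for positive degree, dividing by the top power of `w` does the same
for `Q`. At degree zero, `Q(0) = 0` leaves nothing. -/
theorem eq_zero_of_tendsto_polynomial_mul_log_add {P Q : Polynomial ℝ} {c : ℝ}
    (hQ : Q.coeff 0 = 0)
    (h : Filter.Tendsto (fun w : ℕ => P.eval (w : ℝ) * Real.log (w : ℝ) + Q.eval (w : ℝ))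
      Filter.atTop (nhds c)) : c = 0 := by
  obtain ⟨n, hPn, hQn⟩ : ∃ n, P.natDegree ≤ n ∧ Q.natDegree ≤ n :=
    ⟨max P.natDegree Q.natDegree, le_max_left _ _, le_max_right _ _⟩
  have hlinv := tendsto_log_natCast_atTop.inv_tendsto_atTop
  have hlpos : ∀ᶠ w : ℕ in Filter.atTop, 0 < Real.log (w : ℝ) :=
    tendsto_log_natCast_atTop.eventually_gt_atTop 0
  -- The limit is `0 ^ k`, which is `1` when `k = 0`. For the coefficients of `P` its existence
  -- suffices, since `1 / log w` supplies the decay.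
  have hinv : ∀ k : ℕ, ∃ d : ℝ, Filter.Tendsto (fun w : ℕ => ((w : ℝ) ^ k)⁻¹) Filter.atTop
      (nhds d) ∧ (k ≠ 0 → d = 0) := fun k =>
    ⟨0 ^ k, by simpa using (tendsto_inv_atTop_nhds_zero_nat (𝕜 := ℝ)).pow k, fun hk => by simp [hk]⟩
  have hPcoeff : ∀ n, P.natDegree ≤ n → Q.natDegree ≤ n → P.coeff n = 0 := by
    intro n hPn hQn
    obtain ⟨d, hd, -⟩ := hinv n
    have h1 := (h.mul hd).mul hlinv
    have h2 := (tendsto_eval_div_pow hPn).add ((tendsto_eval_div_pow hQn).mul hlinv)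
    rw [mul_zero, add_zero] at h2
    rw [mul_zero] at h1
    refine tendsto_nhds_unique h2 (h1.congr' ?_)
    filter_upwards [hlpos] with w hw
    simp only [Pi.inv_apply]
    field_simp
  induction n with
  | zero =>
    have hP0 := hPcoeff 0 hPn hQn
    rw [Polynomial.eq_C_of_natDegree_le_zero hPn, Polynomial.eq_C_of_natDegree_le_zero hQn,
      hP0, hQ] at h
    exact tendsto_nhds_unique h (tendsto_const_nhds.congr fun w => by simp)
  | succ n ih =>
    have hPn' := natDegree_le_of_coeff_succ_eq_zero hPn (hPcoeff _ hPn hQn)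
    refine ih hPn' (natDegree_le_of_coeff_succ_eq_zero hQn ?_)
    obtain ⟨d, hd, hd0⟩ := hinv (n + 1)
    rw [hd0 (Nat.succ_ne_zero n)] at hd
    have hlw : Filter.Tendsto (fun w : ℕ => Real.log (w : ℝ) / (w : ℝ)) Filter.atTop (nhds 0) := by
      have := (Real.isLittleO_log_id_atTop.tendsto_div_nhds_zero).comp
        (tendsto_natCast_atTop_atTop (R := ℝ))
      exact this
    have h1 := (h.mul hd).sub ((tendsto_eval_div_pow hPn').mul hlw)
    rw [mul_zero, mul_zero, sub_zero] at h1
    refine tendsto_nhds_unique (tendsto_eval_div_pow hQn) (h1.congr' ?_)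
    filter_upwards [Filter.eventually_gt_atTop 0] with w hw
    have hw' : (w : ℝ) ≠ 0 := by positivity
    field_simp
    ring

theorem IsGKBConstant.unique {k : ℕ} {c d : ℝ} (hc : IsGKBConstant k c) (hd : IsGKBConstant k d) :
    c = d := by
  obtain ⟨P, Q, hQ, h⟩ := hc
  obtain ⟨P', Q', hQ', h'⟩ := hd
  have := eq_zero_of_tendsto_polynomial_mul_log_add (P := P' - P) (Q := Q' - Q) (c := c - d)
    (by simp [hQ, hQ']) ((h.sub h').congr fun w => by simp; ring)
  linarith

/-! ### The constants `L_n` and Adamchik's formula. -/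

/-- The two conventions differ only at `B_1`, that is at `n = 0`, where `H_0 = 0`. -/
theorem harmonic_mul_bernoulli' (n : ℕ) :
    (harmonic n : ℝ) * (bernoulli' (n + 1) : ℝ) = (harmonic n : ℝ) * (bernoulli (n + 1) : ℝ) := by
  rcases Nat.eq_zero_or_pos n with rfl | hn
  · simp
  · rw [bernoulli_eq_bernoulli'_of_ne_one (by omega)]

/-- In the Euler-Maclaurin expansion, the only term free of both `log w` and positive powers of `w`
is the harmonic part of `j = n`. It equals `H_n B_{n+1}/(n+1)` and must be moved out of `Q` to keep
`Q(0) = 0`. -/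
theorem isGKBConstant_of_tendsto_powMulLogRemainder {n : ℕ} {c : ℝ}
    (h : Filter.Tendsto (powMulLogRemainder n) Filter.atTop (nhds c)) :
    IsGKBConstant n (c + (harmonic n : ℝ) * (bernoulli (n + 1) : ℝ) / ((n : ℝ) + 1)) := by
  set b : ℕ → ℝ := fun j => (bernoulli' (j + 1) : ℝ) / ((j + 1).factorial : ℝ) *
    (n.descFactorial j : ℝ) with hb
  refine ⟨Polynomial.C (1 / ((n : ℝ) + 1)) * Polynomial.X ^ (n + 1)
      + ∑ j ∈ Finset.range (n + 1), Polynomial.C (b j) * Polynomial.X ^ (n - j),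
    ∑ j ∈ Finset.range n, Polynomial.C (b j * ((harmonic n : ℝ) - (harmonic (n - j) : ℝ))) *
      Polynomial.X ^ (n - j) - Polynomial.C (1 / ((n : ℝ) + 1) ^ 2) * Polynomial.X ^ (n + 1),
    ?_, ?_⟩
  · simp only [Polynomial.coeff_sub, Polynomial.finsetSum_coeff, Polynomial.coeff_C_mul_X_pow]
    rw [Finset.sum_eq_zero]
    · simp
    · intro j hj
      have := Finset.mem_range.mp hj
      rw [if_neg (by omega)]
  · have h2 := h.add_const ((harmonic n : ℝ) * (bernoulli (n + 1) : ℝ) / ((n : ℝ) + 1))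
    refine h2.congr fun w => ?_
    have hbn : b n = (bernoulli' (n + 1) : ℝ) / ((n : ℝ) + 1) := by
      simp only [hb, Nat.descFactorial_self, Nat.factorial_succ]
      have := Nat.factorial_ne_zero n
      push_cast
      field_simp
    have hsum : ∑ j ∈ Finset.range (n + 1), ((bernoulli' (j + 1) : ℝ) / ((j + 1).factorial : ℝ))
          * powMulLogDeriv n j w
        = (∑ j ∈ Finset.range (n + 1), b j * (w : ℝ) ^ (n - j)) * Real.log w
          + (∑ j ∈ Finset.range n, b j * ((harmonic n : ℝ) - (harmonic (n - j) : ℝ)) *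
            (w : ℝ) ^ (n - j)) + b n * (harmonic n : ℝ) := by
      have : b n * (harmonic n : ℝ)
          = b n * ((harmonic n : ℝ) - (harmonic (n - n) : ℝ)) * (w : ℝ) ^ (n - n) := by simp
      rw [this, add_assoc, ← Finset.sum_range_succ (fun j => b j * ((harmonic n : ℝ) -
        (harmonic (n - j) : ℝ)) * (w : ℝ) ^ (n - j)), Finset.sum_mul, ← Finset.sum_add_distrib]
      refine Finset.sum_congr rfl fun j _ => ?_
      simp only [hb, powMulLogDeriv]
      ring
    rw [powMulLogRemainder, hsum, hbn, ← harmonic_mul_bernoulli', powMulLogPrimitive]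
    simp only [Polynomial.eval_add, Polynomial.eval_sub, Polynomial.eval_mul, Polynomial.eval_C,
      Polynomial.eval_pow, Polynomial.eval_X, Polynomial.eval_finsetSum]
    field_simp
    ring

theorem isGKBConstant_gkbL (k : ℕ) : IsGKBConstant k (gkbL k) := by
  obtain ⟨c, hc, -⟩ := exists_tendsto_powMulLogRemainder k
  exact Classical.epsilon_spec (p := IsGKBConstant k)
    ⟨_, isGKBConstant_of_tendsto_powMulLogRemainder hc⟩

theorem isGKBConstant_iff (k : ℕ) (c : ℝ) : IsGKBConstant k c ↔ c = gkbL k :=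
  ⟨fun h => h.unique (isGKBConstant_gkbL k), fun h => h ▸ isGKBConstant_gkbL k⟩

theorem tendsto_powMulLogRemainder (n : ℕ) :
    Filter.Tendsto (powMulLogRemainder n) Filter.atTop
      (nhds (gkbL n - (harmonic n : ℝ) * (bernoulli (n + 1) : ℝ) / ((n : ℝ) + 1))) := by
  obtain ⟨c, hc, -⟩ := exists_tendsto_powMulLogRemainder n
  rw [← (isGKBConstant_iff n _).mp (isGKBConstant_of_tendsto_powMulLogRemainder hc),
    add_sub_cancel_right]
  exact hc

theorem deriv_riemannZeta_neg_natCast (n : ℕ) : deriv riemannZeta (-(n : ℂ))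
    = (harmonic n : ℂ) * (bernoulli (n + 1) : ℂ) / ((n : ℂ) + 1) - (gkbL n : ℂ) := by
  obtain ⟨c, hc, hz⟩ := exists_tendsto_powMulLogRemainder n
  rw [hz, tendsto_nhds_unique hc (tendsto_powMulLogRemainder n)]
  push_cast
  ring

/-! ### Calculus of `φ_n`, `log Γ`, the nested integrals and `ψ_n`. -/

theorem bernoulliFun_add_one (k : ℕ) (x : ℝ) :
    bernoulliFun k (x + 1) = bernoulliFun k x + k * x ^ (k - 1) := by
  have h := congrArg (fun p => (Polynomial.map (algebraMap ℚ ℝ) p).eval x)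
    (Polynomial.bernoulli_comp_one_add_X k)
  simpa [bernoulliFun, Polynomial.map_comp, Polynomial.eval_comp, add_comm] using h

theorem bernoulliPhi_eq (n : ℕ) (x : ℝ) :
    bernoulliPhi n x = (bernoulliFun (n + 1) x - (bernoulli (n + 1) : ℝ)) / ((n : ℝ) + 1) := by
  rw [bernoulliPhi, bernoulliFun, Polynomial.eval_map_algebraMap]

theorem bernoulliPhi_add_one (n : ℕ) (x : ℝ) :
    bernoulliPhi n (x + 1) = bernoulliPhi n x + x ^ n := by
  rw [bernoulliPhi_eq, bernoulliPhi_eq, bernoulliFun_add_one]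
  have : (n : ℝ) + 1 ≠ 0 := by positivity
  push_cast
  field_simp
  ring

theorem bernoulliPhi_one {n : ℕ} (hn : n ≠ 0) : bernoulliPhi n 1 = 0 := by
  rw [bernoulliPhi_eq, bernoulliFun_endpoints_eq_of_ne_one (by omega), bernoulliFun_eval_zero]
  simp

theorem hasDerivAt_bernoulliPhi_succ (n : ℕ) (x : ℝ) :
    HasDerivAt (bernoulliPhi (n + 1)) (bernoulliFun (n + 1) x) x := by
  have h := ((hasDerivAt_bernoulliFun (n + 2) x).sub_const (bernoulli (n + 2) : ℝ)).div_const
    (((n + 1 : ℕ) : ℝ) + 1)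
  rw [show bernoulliPhi (n + 1) = fun x => (bernoulliFun (n + 2) x - (bernoulli (n + 2) : ℝ)) /
    (((n + 1 : ℕ) : ℝ) + 1) from funext fun x => bernoulliPhi_eq (n + 1) x]
  convert! h using 1
  have : (n : ℝ) + 1 + 1 ≠ 0 := by positivity
  push_cast
  rw [show (n : ℝ) + 2 = n + 1 + 1 by ring]
  field_simp

theorem integral_bernoulliPhi_add_one (n : ℕ) :
    ∫ t in (0 : ℝ)..1, bernoulliPhi n (t + 1) = (1 - (bernoulli (n + 1) : ℝ)) / ((n : ℝ) + 1) := by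
  have hc : Continuous fun t : ℝ => bernoulliFun (n + 1) (t + 1) :=
    (continuous_bernoulliFun _).comp (continuous_id.add continuous_const)
  have h1 : ∫ t in (0 : ℝ)..1, bernoulliFun (n + 1) (t + 1) = 1 := by
    rw [intervalIntegral.integral_eq_sub_of_hasDerivAt
      (f := fun t => bernoulliPhi (n + 1) (t + 1))
      (fun t _ => (hasDerivAt_bernoulliPhi_succ n (t + 1)).comp_add_const t 1)
      (hc.intervalIntegrable _ _), bernoulliPhi_add_one]
    simp
  simp_rw [bernoulliPhi_eq]
  rw [intervalIntegral.integral_div, intervalIntegral.integral_sub (hc.intervalIntegrable _ _)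
    intervalIntegrable_const, h1]
  simp

theorem hasDerivAt_log_Gamma_add_one {x : ℝ} (hx : -1 < x) :
    HasDerivAt (fun y => Real.log (Real.Gamma (y + 1)))
      (deriv (fun y => Real.log (Real.Gamma (y + 1))) x) x := by
  have hpos : 0 < x + 1 := by linarith
  refine DifferentiableAt.hasDerivAt ?_
  refine DifferentiableAt.log ?_ (Real.Gamma_pos_of_pos hpos).ne'
  have h : DifferentiableAt ℝ Real.Gamma (x + 1) := Real.differentiableAt_Gamma fun m h => by
    have : (0 : ℝ) ≤ m := by positivity
    linarith
  exact h.comp x (f := fun y => y + 1) (by fun_prop)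

theorem log_Gamma_add_two {x : ℝ} (hx : -1 < x) : Real.log (Real.Gamma (x + 1 + 1))
    = Real.log (Real.Gamma (x + 1)) + Real.log (x + 1) := by
  have hpos : 0 < x + 1 := by linarith
  rw [Real.Gamma_add_one hpos.ne', Real.log_mul hpos.ne' (Real.Gamma_pos_of_pos hpos).ne', add_comm]

/-- Log-convexity of `Γ`. Combined with the recurrence `deriv_log_Gamma_add_one_add_one`, it bounds
the oscillation of the digamma function on unit intervals without any asymptotic expansion. -/
theorem monotoneOn_deriv_log_Gamma_add_one :
    MonotoneOn (deriv fun y => Real.log (Real.Gamma (y + 1))) (Set.Ioi (-1)) := by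
  refine ConvexOn.monotoneOn_deriv ?_ fun x hx => (hasDerivAt_log_Gamma_add_one hx).differentiableAt
  have h := Real.convexOn_log_Gamma.translate_left 1
  convert! h using 1
  · ext x; simp [neg_lt_iff_pos_add]

theorem deriv_log_Gamma_add_one_add_one {x : ℝ} (hx : -1 < x) :
    deriv (fun y => Real.log (Real.Gamma (y + 1))) (x + 1)
      = deriv (fun y => Real.log (Real.Gamma (y + 1))) x + (x + 1)⁻¹ := by
  have h1 := (hasDerivAt_log_Gamma_add_one (x := x + 1) (by linarith)).comp_add_const x 1
  have h2 := (hasDerivAt_log_Gamma_add_one hx).add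
    ((Real.hasDerivAt_log (x := x + 1) (by linarith)).comp_add_const x 1)
  refine h1.unique (h2.congr_of_eventuallyEq ?_)
  filter_upwards [Ioi_mem_nhds hx] with y hy
  exact log_Gamma_add_two hy

theorem uIcc_zero_subset_Ioi {x : ℝ} (hx : -1 < x) : Set.uIcc 0 x ⊆ Set.Ioi (-1) := fun _ hy =>
  (lt_min (by norm_num) hx).trans_le hy.1

theorem continuousOn_nestedLogGamma_and_hasDerivAt (k : ℕ) :
    ContinuousOn (nestedLogGamma k) (Set.Ioi (-1)) ∧
      ∀ x, -1 < x → HasDerivAt (nestedLogGamma (k + 1)) (nestedLogGamma k x) x := by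
  have key : ∀ k, ContinuousOn (nestedLogGamma k) (Set.Ioi (-1)) →
      ∀ x, -1 < x → HasDerivAt (nestedLogGamma (k + 1)) (nestedLogGamma k x) x := by
    intro k hk x hx
    have hxn : Set.Ioi (-1) ∈ nhds x := Ioi_mem_nhds hx
    exact intervalIntegral.integral_hasDerivAt_right
      (hk.mono (uIcc_zero_subset_Ioi hx)).intervalIntegrable
      (hk.stronglyMeasurableAtFilter isOpen_Ioi x hx) (hk.continuousAt hxn)
  suffices h : ContinuousOn (nestedLogGamma k) (Set.Ioi (-1)) from ⟨h, key k h⟩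
  induction k with
  | zero => exact fun x hx => (hasDerivAt_log_Gamma_add_one hx).continuousAt.continuousWithinAt
  | succ k ih => exact fun x hx => (key k ih x hx).continuousAt.continuousWithinAt

theorem hasDerivAt_gkbPsi_succ (n : ℕ) (x : ℝ) :
    HasDerivAt (gkbPsi (n + 1)) (((n : ℝ) + 1) * (gkbPsi n x + gkbL n)) x := by
  have h : HasDerivAt (gkbPsi (n + 1)) (∑ r ∈ Finset.range (n + 1),
      ((n + 1).choose r : ℝ) * gkbL r * (((n + 1 - r : ℕ) : ℝ) * x ^ (n + 1 - r - 1))) x :=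
    HasDerivAt.fun_sum fun r _ => (hasDerivAt_pow (n + 1 - r) x).const_mul _
  convert! h using 1
  have hn : gkbL n = (n.choose n : ℝ) * gkbL n * x ^ (n - n) := by simp
  rw [gkbPsi, hn, ← Finset.sum_range_succ (fun r => (n.choose r : ℝ) * gkbL r * x ^ (n - r)),
    Finset.mul_sum]
  refine Finset.sum_congr rfl fun r _ => ?_
  have hc : (n.choose r : ℝ) * ((n : ℝ) + 1) = ((n + 1).choose r : ℝ) * ((n + 1 - r : ℕ) : ℝ) := by
    exact_mod_cast Nat.choose_mul_succ_eq n r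
  rw [show n + 1 - r - 1 = n - r by omega]
  linear_combination gkbL r * x ^ (n - r) * hc

/-! ### Derivatives of `log Γ_n`. -/

/-- The polynomial part of the derivative of `benderskyLogGamma (n + 1)`. -/
noncomputable def benderskyDerivPoly (n : ℕ) : Polynomial ℝ :=
  Polynomial.C (1 / ((n : ℝ) + 1)) *
      (((Polynomial.bernoulli (n + 1)).map (algebraMap ℚ ℝ)).comp (Polynomial.X + 1)
        - Polynomial.C (bernoulli (n + 1) : ℝ))
    + Polynomial.C ((harmonic (n + 1) : ℝ) * (bernoulli (n + 1) : ℝ) - ((n : ℝ) + 1) * gkbL n)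

theorem eval_benderskyDerivPoly (n : ℕ) (x : ℝ) :
    (benderskyDerivPoly n).eval x = bernoulliPhi n (x + 1)
      + ((harmonic (n + 1) : ℝ) * (bernoulli (n + 1) : ℝ) - ((n : ℝ) + 1) * gkbL n) := by
  rw [bernoulliPhi_eq, bernoulliFun, benderskyDerivPoly]
  simp only [Polynomial.eval_add, Polynomial.eval_sub, Polynomial.eval_mul, Polynomial.eval_C,
    Polynomial.eval_comp, Polynomial.eval_X, Polynomial.eval_one]
  ring

theorem natDegree_benderskyDerivPoly_le (n : ℕ) : (benderskyDerivPoly n).natDegree ≤ n + 1 := by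
  have h1 : (Polynomial.bernoulli (n + 1)).natDegree ≤ n + 1 := by
    rw [Polynomial.natDegree_le_iff_coeff_eq_zero]
    intro N hN
    rw [Polynomial.coeff_bernoulli, if_neg (by omega)]
  have h2 : (((Polynomial.bernoulli (n + 1)).map (algebraMap ℚ ℝ)).comp
      (Polynomial.X + 1)).natDegree ≤ n + 1 := by
    rw [Polynomial.natDegree_comp, ← Polynomial.C_1, Polynomial.natDegree_X_add_C, mul_one]
    exact Polynomial.natDegree_map_le.trans h1
  rw [benderskyDerivPoly, Polynomial.natDegree_add_C]
  refine (Polynomial.natDegree_C_mul_le _ _).trans ?_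
  rwa [Polynomial.natDegree_sub_C]

/-- Splitting `H_{n+1} = H_n + 1/(n+1)` in the Bernoulli term, the `H_n` part completes `(n+1) log
Γ_n` and the rest is polynomial. -/
theorem hasDerivAt_benderskyLogGamma_succ (n : ℕ) {x : ℝ} (hx : -1 < x) :
    HasDerivAt (benderskyLogGamma (n + 1))
      (((n : ℝ) + 1) * benderskyLogGamma n x + (benderskyDerivPoly n).eval x) x := by
  have h := ((((continuousOn_nestedLogGamma_and_hasDerivAt n).2 x hx).const_mul
    ((n + 1).factorial : ℝ)).add (((hasDerivAt_bernoulliPhi_succ n (x + 1)).comp_add_const x 1).const_mul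
    (harmonic (n + 1) : ℝ))).sub (hasDerivAt_gkbPsi_succ n x)
  convert! h using 1
  have hb : bernoulliFun (n + 1) (x + 1)
      = ((n : ℝ) + 1) * bernoulliPhi n (x + 1) + (bernoulli (n + 1) : ℝ) := by
    rw [bernoulliPhi_eq]
    have : (n : ℝ) + 1 ≠ 0 := by positivity
    field_simp
    ring
  rw [eval_benderskyDerivPoly, benderskyLogGamma, hb, Nat.factorial_succ, harmonic_succ]
  have : (n : ℝ) + 1 ≠ 0 := by positivity
  push_cast
  field_simp
  ring

theorem benderskyLogGamma_zero (x : ℝ) :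
    benderskyLogGamma 0 x = Real.log (Real.Gamma (x + 1)) := by
  simp [benderskyLogGamma, nestedLogGamma, gkbPsi]

theorem benderskyLogGamma_apply_zero (n : ℕ) : benderskyLogGamma n 0 = 0 := by
  cases n with
  | zero => simp [benderskyLogGamma_zero]
  | succ n =>
    have h : gkbPsi (n + 1) 0 = 0 := Finset.sum_eq_zero fun r hr => by
      have : n + 1 - r ≠ 0 := by have := Finset.mem_range.mp hr; omega
      simp [this]
    simp [benderskyLogGamma, nestedLogGamma, h, bernoulliPhi_one]

/-- Each level adds a polynomial of degree at most `n + 1`, whose derivative of order `n + 1` is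
constant. The last derivative is thus an affine function of digamma, the form needed to control the
Euler-Maclaurin remainder. -/
theorem exists_iterated_derivatives_benderskyLogGamma (n : ℕ) :
    ∃ (g : ℕ → ℝ → ℝ) (c : ℝ), g 0 = benderskyLogGamma n ∧
      (∀ i ≤ n, ∀ x, -1 < x → HasDerivAt (g i) (g (i + 1) x) x) ∧
      ∀ x, g (n + 1) x
        = (n.factorial : ℝ) * deriv (fun y => Real.log (Real.Gamma (y + 1))) x + c := by
  induction n with
  | zero =>
    refine ⟨fun i => if i = 0 then benderskyLogGamma 0 else
      deriv fun y => Real.log (Real.Gamma (y + 1)), 0, by simp, ?_, by simp⟩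
    intro i hi x hx
    obtain rfl : i = 0 := by omega
    have : benderskyLogGamma 0 = fun y => Real.log (Real.Gamma (y + 1)) :=
      funext benderskyLogGamma_zero
    simpa [this] using hasDerivAt_log_Gamma_add_one hx
  | succ n ih =>
    obtain ⟨g, c, h0, hd, hl⟩ := ih
    have hp : (Polynomial.derivative^[n + 1] (benderskyDerivPoly n)).natDegree ≤ 0 :=
      (Polynomial.natDegree_iterate_derivative _ _).trans
        (by have := natDegree_benderskyDerivPoly_le n; omega)
    refine ⟨fun i => Nat.casesOn i (benderskyLogGamma (n + 1)) fun i x =>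
        ((n : ℝ) + 1) * g i x + (Polynomial.derivative^[i] (benderskyDerivPoly n)).eval x,
      ((n : ℝ) + 1) * c + (Polynomial.derivative^[n + 1] (benderskyDerivPoly n)).coeff 0,
      rfl, ?_, ?_⟩
    · intro i hi x hx
      cases i with
      | zero =>
        have := hasDerivAt_benderskyLogGamma_succ n hx
        rw [← h0] at this
        exact this
      | succ i =>
        have := ((hd i (by omega) x hx).const_mul ((n : ℝ) + 1)).add
          ((Polynomial.derivative^[i] (benderskyDerivPoly n)).hasDerivAt x)
        rw [← Function.iterate_succ_apply' Polynomial.derivative] at this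
        exact this
    · intro x
      show ((n : ℝ) + 1) * g (n + 1) x
        + (Polynomial.derivative^[n + 1] (benderskyDerivPoly n)).eval x = _
      rw [hl, Polynomial.eq_C_of_natDegree_le_zero hp, Polynomial.eval_C, Polynomial.coeff_C_zero,
        Nat.factorial_succ]
      push_cast
      ring

/-! ### The difference equation and Raabe's formula. -/

/-- The bound `i < n` is sharp: at `i = n` the true derivative is `n!/t`, while `powMulLogDeriv n (n
+ 1)` is zero. -/
theorem hasDerivAt_powMulLogDeriv {n i : ℕ} (hi : i < n) {t : ℝ} (ht : t ≠ 0) :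
    HasDerivAt (powMulLogDeriv n i) (powMulLogDeriv n (i + 1) t) t := by
  have h := ((hasDerivAt_pow (n - i) t).const_mul (n.descFactorial i : ℝ)).mul
    ((Real.hasDerivAt_log ht).add_const ((harmonic n : ℝ) - (harmonic (n - i) : ℝ)))
  convert! h using 1
  obtain ⟨k, rfl⟩ : ∃ k, n = i + 1 + k := ⟨n - (i + 1), by omega⟩
  simp only [powMulLogDeriv]
  rw [Nat.descFactorial_succ, show i + 1 + k - i = k + 1 by omega,
    show i + 1 + k - (i + 1) = k by omega, harmonic_succ k]
  have : (k : ℝ) + 1 ≠ 0 := by positivity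
  push_cast
  field_simp
  ring

theorem powMulLogDeriv_zero (n : ℕ) (t : ℝ) : powMulLogDeriv n 0 t = t ^ n * Real.log t := by
  simp [powMulLogDeriv]

theorem hasDerivAt_powMulLogPrimitive (n : ℕ) {t : ℝ} (ht : t ≠ 0) :
    HasDerivAt (powMulLogPrimitive n) (t ^ n * Real.log t) t := by
  have h := ((hasDerivAt_pow (n + 1) t).div_const ((n : ℝ) + 1)).mul
    ((Real.hasDerivAt_log ht).sub_const (1 / ((n : ℝ) + 1)))
  convert! h using 1
  have : (n : ℝ) + 1 ≠ 0 := by positivity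
  push_cast
  field_simp
  ring

theorem integral_add_pow_mul_log {a : ℝ} (ha : 0 < a) (n : ℕ) :
    ∫ t in (0 : ℝ)..1, (a + t) ^ n * Real.log (a + t)
      = powMulLogPrimitive n (a + 1) - powMulLogPrimitive n a := by
  have hpos : ∀ t ∈ Set.uIcc (0 : ℝ) 1, a + t ≠ 0 := fun t ht => by
    rw [Set.uIcc_of_le zero_le_one] at ht
    linarith [ht.1]
  rw [intervalIntegral.integral_eq_sub_of_hasDerivAt (f := fun t => powMulLogPrimitive n (a + t))
    (fun t ht => (hasDerivAt_powMulLogPrimitive n (hpos t ht)).comp_const_add a t), add_zero]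
  refine ContinuousOn.intervalIntegrable (ContinuousOn.mul (by fun_prop) ?_)
  exact ContinuousOn.log (by fun_prop) hpos

theorem continuousOn_benderskyLogGamma (n : ℕ) :
    ContinuousOn (benderskyLogGamma n) (Set.Ioi (-1)) := by
  obtain ⟨g, c, h0, hd, -⟩ := exists_iterated_derivatives_benderskyLogGamma n
  rw [← h0]
  exact fun x hx => (hd 0 (Nat.zero_le n) x hx).continuousAt.continuousWithinAt

theorem intervalIntegrable_benderskyLogGamma (n : ℕ) {a : ℝ} (ha : 0 ≤ a) :
    IntervalIntegrable (fun t => benderskyLogGamma n (a + t)) MeasureTheory.volume 0 1 := by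
  refine ContinuousOn.intervalIntegrable
    ((continuousOn_benderskyLogGamma n).comp (by fun_prop) fun t ht => ?_)
  rw [Set.uIcc_of_le zero_le_one] at ht
  show -1 < a + t
  linarith [ht.1]

/-- The difference equation characterising `benderskyLogGamma n`. -/
def SatisfiesBenderskyEquation (n : ℕ) : Prop :=
  ∀ x : ℝ, -1 < x →
    benderskyLogGamma n (x + 1) = benderskyLogGamma n x + (x + 1) ^ n * Real.log (x + 1)

theorem SatisfiesBenderskyEquation.apply_natCast {n : ℕ} (h : SatisfiesBenderskyEquation n)
    (w : ℕ) : benderskyLogGamma n (w : ℝ)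
      = ∑ m ∈ Finset.Icc 1 w, (m : ℝ) ^ n * Real.log (m : ℝ) := by
  induction w with
  | zero => simp [benderskyLogGamma_apply_zero]
  | succ w ih =>
    rw [Finset.sum_Icc_succ_top (Nat.le_add_left 1 w), ← ih]
    push_cast
    exact h w (by have : (0 : ℝ) ≤ w := by positivity
                  linarith)

theorem SatisfiesBenderskyEquation.iterated_derivatives_sub {n : ℕ}
    (h : SatisfiesBenderskyEquation n) {g : ℕ → ℝ → ℝ} (h0 : g 0 = benderskyLogGamma n)
    (hd : ∀ i ≤ n, ∀ x, -1 < x → HasDerivAt (g i) (g (i + 1) x) x) {i : ℕ} (hi : i ≤ n) :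
    ∀ x, -1 < x → g i (x + 1) - g i x = powMulLogDeriv n i (x + 1) := by
  induction i with
  | zero =>
    intro x hx
    rw [h0, h x hx, powMulLogDeriv_zero]
    ring
  | succ i ih =>
    intro x hx
    have h1 := ((hd i (by omega) (x + 1) (by linarith)).comp_add_const x 1).sub
      (hd i (by omega) x hx)
    have h2 := (hasDerivAt_powMulLogDeriv (n := n) (i := i) (by omega)
      (t := x + 1) (by linarith)).comp_add_const x 1
    refine h1.unique (h2.congr_of_eventuallyEq ?_)
    filter_upwards [Ioi_mem_nhds hx] with y hy
    exact ih (by omega) y hy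

theorem SatisfiesBenderskyEquation.integral_shift {n : ℕ} (h : SatisfiesBenderskyEquation n)
    (w : ℕ) : ∫ t in (0 : ℝ)..1, benderskyLogGamma n (w + t)
      = (∫ t in (0 : ℝ)..1, benderskyLogGamma n t)
        + (powMulLogPrimitive n (w + 1) - powMulLogPrimitive n 1) := by
  induction w with
  | zero => simp
  | succ w ih =>
    have hw : (0 : ℝ) ≤ w := by positivity
    have h1 : ∫ t in (0 : ℝ)..1, benderskyLogGamma n ((w + 1 : ℕ) + t)
        = ∫ t in (0 : ℝ)..1, (benderskyLogGamma n (w + t)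
          + ((w + 1 : ℝ) + t) ^ n * Real.log ((w + 1 : ℝ) + t)) := by
      refine intervalIntegral.integral_congr fun t ht => ?_
      rw [Set.uIcc_of_le zero_le_one] at ht
      have := h (w + t) (by linarith [ht.1])
      rw [show ((w + 1 : ℕ) : ℝ) + t = w + t + 1 by push_cast; ring, this,
        show (w : ℝ) + 1 + t = w + t + 1 by ring]
    have hlog : IntervalIntegrable (fun t => ((w + 1 : ℝ) + t) ^ n * Real.log ((w + 1 : ℝ) + t))
        MeasureTheory.volume 0 1 := by
      refine ContinuousOn.intervalIntegrable (ContinuousOn.mul (by fun_prop)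
        (ContinuousOn.log (by fun_prop) fun t ht => ?_))
      rw [Set.uIcc_of_le zero_le_one] at ht
      linarith [ht.1]
    rw [h1, intervalIntegral.integral_add (intervalIntegrable_benderskyLogGamma n hw) hlog, ih,
      integral_add_pow_mul_log (by linarith)]
    push_cast
    ring

/-- The Bernoulli kernel has mean zero, so only the deviation of digamma from its value at the left
endpoint counts. By monotonicity and the recurrence this is at most `1/(w+1)`. -/
theorem tendsto_integral_bernoulliFun_mul_of_digamma {n : ℕ} {f : ℝ → ℝ} {a c : ℝ}
    (hf : ∀ x, f x = a * deriv (fun y => Real.log (Real.Gamma (y + 1))) x + c) :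
    Filter.Tendsto (fun w : ℕ => ∫ t in (0 : ℝ)..1,
      (bernoulliFun (n + 1) t / ((n + 1).factorial : ℝ)) • f (w + t)) Filter.atTop (nhds 0) := by
  set ψ := deriv fun y => Real.log (Real.Gamma (y + 1)) with hψ
  set K : ℝ → ℝ := fun t => bernoulliFun (n + 1) t / ((n + 1).factorial : ℝ) with hK
  have hKc : Continuous K := (continuous_bernoulliFun _).div_const _
  have hK0 : ∫ t in (0 : ℝ)..1, K t = 0 := by
    rw [hK, intervalIntegral.integral_div, integral_bernoulliFun_eq_zero (Nat.succ_ne_zero n),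
      zero_div]
  obtain ⟨B, hB⟩ := (isCompact_Icc (a := (0 : ℝ)) (b := 1)).exists_bound_of_continuousOn
    hKc.continuousOn
  have hB0 : 0 ≤ B := (norm_nonneg _).trans (hB 0 (by simp))
  have hmono : ∀ w : ℕ, MonotoneOn (fun t => ψ (w + t)) (Set.Icc 0 1) := by
    intro w x hx y hy hxy
    have hw : (0 : ℝ) ≤ w := by positivity
    exact monotoneOn_deriv_log_Gamma_add_one (Set.mem_Ioi.mpr (by linarith [hx.1]))
      (Set.mem_Ioi.mpr (by linarith [hy.1])) (by linarith)
  have heq : ∀ w : ℕ, ∫ t in (0 : ℝ)..1, K t • f (w + t)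
      = ∫ t in (0 : ℝ)..1, K t * (a * (ψ (w + t) - ψ w)) := by
    intro w
    have hψi : IntervalIntegrable (fun t => ψ (w + t)) MeasureTheory.volume 0 1 := by
      refine MonotoneOn.intervalIntegrable ?_
      rw [Set.uIcc_of_le zero_le_one]
      exact hmono w
    have h1 : IntervalIntegrable (fun t => K t * (a * (ψ (w + t) - ψ w)))
        MeasureTheory.volume 0 1 :=
      ((hψi.sub intervalIntegrable_const).const_mul a).continuousOn_mul hKc.continuousOn
    have h2 : IntervalIntegrable (fun t => K t * (a * ψ w + c)) MeasureTheory.volume 0 1 :=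
      (hKc.mul continuous_const).intervalIntegrable _ _
    have h3 := intervalIntegral.integral_add h1 h2
    rw [intervalIntegral.integral_mul_const, hK0, zero_mul, add_zero] at h3
    rw [← h3]
    refine intervalIntegral.integral_congr fun t _ => ?_
    simp only [hf, smul_eq_mul]
    ring
  have hlim : Filter.Tendsto (fun w : ℕ => B * (|a| * ((w + 1 : ℕ) : ℝ)⁻¹)) Filter.atTop
      (nhds 0) := by
    have := (tendsto_inv_atTop_nhds_zero_nat (𝕜 := ℝ)).comp (Filter.tendsto_add_atTop_nat 1)
    simpa using (this.const_mul |a|).const_mul B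
  refine squeeze_zero_norm (fun w => ?_) hlim
  rw [heq]
  have hle := intervalIntegral.norm_integral_le_of_norm_le_const (a := (0 : ℝ)) (b := 1)
    (f := fun t => K t * (a * (ψ (w + t) - ψ w))) (C := B * (|a| * ((w + 1 : ℕ) : ℝ)⁻¹)) ?_
  · simpa using hle
  intro t ht
  rw [Set.uIoc_of_le zero_le_one] at ht
  have hw : (0 : ℝ) ≤ w := by positivity
  have h0 := hmono w (Set.left_mem_Icc.mpr zero_le_one) ⟨ht.1.le, ht.2⟩ ht.1.le
  have h1 := hmono w ⟨ht.1.le, ht.2⟩ (Set.right_mem_Icc.mpr zero_le_one) ht.2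
  simp only [add_zero] at h0 h1
  rw [hψ, deriv_log_Gamma_add_one_add_one (by linarith), ← hψ] at h1
  rw [norm_mul, norm_mul, Real.norm_eq_abs a, Real.norm_eq_abs (ψ (w + t) - ψ w),
    abs_of_nonneg (sub_nonneg.mpr h0)]
  have h2 : ψ (w + t) - ψ w ≤ ((w + 1 : ℕ) : ℝ)⁻¹ := by push_cast; linarith
  have h3 := hB t ⟨ht.1.le, ht.2⟩
  have h4 : 0 ≤ ψ (w + t) - ψ w := sub_nonneg.mpr h0
  gcongr

/-- The generalisation of Raabe's formula. -/
theorem SatisfiesBenderskyEquation.integral_eq {n : ℕ} (h : SatisfiesBenderskyEquation n) :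
    ∫ t in (0 : ℝ)..1, benderskyLogGamma n t
      = gkbL n - (harmonic n : ℝ) * (bernoulli (n + 1) : ℝ) / ((n : ℝ) + 1)
        - 1 / ((n : ℝ) + 1) ^ 2 := by
  obtain ⟨g, c, h0, hd, hl⟩ := exists_iterated_derivatives_benderskyLogGamma n
  have hrem := (tendsto_integral_bernoulliFun_mul_of_digamma (n := n) hl).const_smul
    ((-1 : ℝ) ^ (n + 1))
  have hlim := (tendsto_powMulLogRemainder n).comp (Filter.tendsto_add_atTop_nat 1)
  have h1 := hlim.add hrem
  have hp1 : powMulLogPrimitive n 1 = -(1 / ((n : ℝ) + 1) ^ 2) := by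
    simp [powMulLogPrimitive, sq]
  -- Euler-Maclaurin on `[w, w+1]`: by the difference equation, the boundary increments are the
  -- derivatives of `t ^ n log t` at `w + 1`, exactly those in `powMulLogRemainder n (w + 1)`. Hence
  -- that remainder plus the Euler-Maclaurin integral does not depend on `w`.
  have h2 : Filter.Tendsto (fun _ : ℕ => (∫ t in (0 : ℝ)..1, benderskyLogGamma n t)
      - powMulLogPrimitive n 1) Filter.atTop
      (nhds (gkbL n - (harmonic n : ℝ) * (bernoulli (n + 1) : ℝ) / ((n : ℝ) + 1)
        + (-1 : ℝ) ^ (n + 1) • (0 : ℝ))) := by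
    refine h1.congr fun w => ?_
    have hw : (0 : ℝ) ≤ w := by positivity
    have hgi : IntervalIntegrable (fun t => g (n + 1) (w + t)) MeasureTheory.volume 0 1 := by
      simp only [hl]
      refine (IntervalIntegrable.const_mul (MonotoneOn.intervalIntegrable ?_) _).add
        intervalIntegrable_const
      rw [Set.uIcc_of_le zero_le_one]
      intro x hx y hy hxy
      exact monotoneOn_deriv_log_Gamma_add_one (Set.mem_Ioi.mpr (by linarith [hx.1]))
        (Set.mem_Ioi.mpr (by linarith [hy.1])) (by linarith)
    have hem := integral_eq_sub_sum_bernoulli'_smul (fun j t => g j (w + t)) n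
      (fun j hj t ht => (hd j hj (w + t) (by linarith [ht.1])).comp_const_add (w : ℝ) t) hgi
    have hs := h.integral_shift w
    have hs2 : ∑ j ∈ Finset.range (n + 1),
          ((bernoulli' (j + 1) : ℝ) / ((j + 1).factorial : ℝ)) • (g j (w + 1) - g j (w + 0))
        = ∑ j ∈ Finset.range (n + 1), ((bernoulli' (j + 1) : ℝ) / ((j + 1).factorial : ℝ))
          * powMulLogDeriv n j ((w + 1 : ℕ) : ℝ) := by
      refine Finset.sum_congr rfl fun j hj => ?_
      rw [add_zero, h.iterated_derivatives_sub h0 hd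
        (Nat.lt_succ_iff.mp (Finset.mem_range.mp hj)) w (by linarith), smul_eq_mul]
      push_cast
      rfl
    rw [hs2] at hem
    simp only [h0] at hem
    rw [hs] at hem
    have hG := h.apply_natCast (w + 1)
    simp only [Function.comp_apply, powMulLogRemainder]
    rw [← hG]
    push_cast at hem ⊢
    linear_combination -hem
  rw [smul_zero, add_zero] at h2
  have h3 := tendsto_nhds_unique h2 tendsto_const_nhds
  rw [hp1] at h3
  linarith

/-- Induction on `n`: the defect at level `n + 1` has zero derivative by the equation at level `n`
and `φ_n(x+1) - φ_n(x) = x ^ n`. It is therefore constant, and its value at `0` is `G_{n+1}(1)`. -/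
theorem satisfiesBenderskyEquation (n : ℕ) : SatisfiesBenderskyEquation n := by
  induction n with
  | zero =>
    intro x hx
    simp only [benderskyLogGamma_zero, pow_zero, one_mul]
    exact log_Gamma_add_two hx
  | succ n ih =>
    have hn : (n : ℝ) + 1 ≠ 0 := by positivity
    have hphi : Continuous fun t : ℝ => (benderskyDerivPoly n).eval t :=
      (benderskyDerivPoly n).continuous
    have hG : IntervalIntegrable (benderskyLogGamma n) MeasureTheory.volume 0 1 := by
      simpa using intervalIntegrable_benderskyLogGamma n le_rfl
    -- `G_{n+1}(1)` is the integral of `G_{n+1}'` over `[0, 1]`; the Raabe formula at level `n`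
    -- cancels the polynomial part, including `L_n`.
    have hone : benderskyLogGamma (n + 1) 1 = 0 := by
      have h1 := intervalIntegral.integral_eq_sub_of_hasDerivAt (a := (0 : ℝ)) (b := 1)
        (f := benderskyLogGamma (n + 1))
        (f' := fun x => ((n : ℝ) + 1) * benderskyLogGamma n x + (benderskyDerivPoly n).eval x)
        (fun x hx => hasDerivAt_benderskyLogGamma_succ n (by
          rw [Set.uIcc_of_le zero_le_one] at hx; linarith [hx.1]))
        ((hG.const_mul _).add (hphi.intervalIntegrable _ _))
      have h2 : ∫ t in (0 : ℝ)..1, (benderskyDerivPoly n).eval t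
          = (1 - (bernoulli (n + 1) : ℝ)) / ((n : ℝ) + 1)
            + ((harmonic (n + 1) : ℝ) * (bernoulli (n + 1) : ℝ) - ((n : ℝ) + 1) * gkbL n) := by
        have hc : Continuous fun t : ℝ => bernoulliPhi n (t + 1) := by
          have : (fun t : ℝ => bernoulliPhi n (t + 1)) = fun t => (benderskyDerivPoly n).eval t
              - ((harmonic (n + 1) : ℝ) * (bernoulli (n + 1) : ℝ) - ((n : ℝ) + 1) * gkbL n) := by
            ext t; rw [eval_benderskyDerivPoly]; ring
          rw [this]
          exact hphi.sub continuous_const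
        simp only [eval_benderskyDerivPoly]
        rw [intervalIntegral.integral_add (hc.intervalIntegrable _ _) intervalIntegrable_const,
          integral_bernoulliPhi_add_one]
        simp
      rw [intervalIntegral.integral_add (hG.const_mul _) (hphi.intervalIntegrable _ _),
        intervalIntegral.integral_const_mul, ih.integral_eq, h2, benderskyLogGamma_apply_zero,
        sub_zero, harmonic_succ] at h1
      rw [← h1]
      push_cast
      field_simp
      ring
    have hderiv : ∀ x : ℝ, -1 < x → HasDerivAt (fun x => benderskyLogGamma (n + 1) (x + 1)
        - benderskyLogGamma (n + 1) x - powMulLogDeriv (n + 1) 0 (x + 1)) 0 x := by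
      intro x hx
      have h1 := (((hasDerivAt_benderskyLogGamma_succ n (x := x + 1)
        (by linarith)).comp_add_const x 1).sub (hasDerivAt_benderskyLogGamma_succ n hx)).sub
        ((hasDerivAt_powMulLogDeriv (Nat.succ_pos n) (t := x + 1)
          (by linarith)).comp_add_const x 1)
      convert! h1 using 1
      rw [ih x hx, eval_benderskyDerivPoly, eval_benderskyDerivPoly,
        bernoulliPhi_add_one n (x + 1), powMulLogDeriv, harmonic_succ]
      simp
      field_simp
      ring
    intro x hx
    have hconst := (convex_Ioi (-1 : ℝ)).is_const_of_fderivWithin_eq_zero (𝕜 := ℝ)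
      (f := fun x => benderskyLogGamma (n + 1) (x + 1)
        - benderskyLogGamma (n + 1) x - powMulLogDeriv (n + 1) 0 (x + 1))
      (fun y hy => (hderiv y hy).differentiableAt.differentiableWithinAt) ?_
      (Set.mem_Ioi.mpr hx) (Set.mem_Ioi.mpr (show (-1 : ℝ) < 0 by norm_num))
    · simp only [powMulLogDeriv_zero, zero_add, hone, benderskyLogGamma_apply_zero,
        Real.log_one, mul_zero, sub_zero] at hconst
      linarith
    · intro y hy
      rw [fderivWithin_of_isOpen isOpen_Ioi hy]
      ext
      simpa using (hderiv y hy).deriv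

/-! ### The integral formula at `x = 1`. -/

theorem intervalIntegrable_pow_mul_nestedLogGamma (i k : ℕ) :
    IntervalIntegrable (fun t : ℝ => (1 - t) ^ i * nestedLogGamma k t)
      MeasureTheory.volume 0 1 := by
  refine ContinuousOn.intervalIntegrable (ContinuousOn.mul (by fun_prop) ?_)
  exact (continuousOn_nestedLogGamma_and_hasDerivAt k).1.mono (uIcc_zero_subset_Ioi (by norm_num))

/-- Cauchy's formula for repeated integration. In each integration by parts the boundary terms
vanish, at `1` through the power of `1 - t` and at `0` through the nested integral. -/
theorem integral_pow_mul_nestedLogGamma (i k : ℕ) :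
    ∫ t in (0 : ℝ)..1, (1 - t) ^ i * nestedLogGamma k t
      = (i.factorial : ℝ) * nestedLogGamma (k + i + 1) 1 := by
  induction i generalizing k with
  | zero => simp [nestedLogGamma]
  | succ i ih =>
    have h := intervalIntegral.integral_mul_deriv_eq_deriv_mul (a := (0 : ℝ)) (b := 1)
      (u := fun t => (1 - t) ^ (i + 1)) (u' := fun t => -(((i : ℝ) + 1) * (1 - t) ^ i))
      (v := nestedLogGamma (k + 1)) (v' := nestedLogGamma k)
      (fun t _ => by
        have := ((hasDerivAt_id t).const_sub 1).pow (i + 1)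
        convert! this using 1
        simp)
      (fun t ht => (continuousOn_nestedLogGamma_and_hasDerivAt k).2 t
        (uIcc_zero_subset_Ioi (by norm_num) ht))
      ((by fun_prop : Continuous fun t : ℝ => -(((i : ℝ) + 1) * (1 - t) ^ i)).intervalIntegrable
        _ _)
      (by simpa using intervalIntegrable_pow_mul_nestedLogGamma 0 k)
    have h0 : nestedLogGamma (k + 1) 0 = 0 := by simp [nestedLogGamma]
    rw [h, h0]
    have h1 : ∀ t : ℝ, -(((i : ℝ) + 1) * (1 - t) ^ i) * nestedLogGamma (k + 1) t
        = -((i : ℝ) + 1) * ((1 - t) ^ i * nestedLogGamma (k + 1) t) := fun t => by ring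
    simp only [h1]
    rw [intervalIntegral.integral_const_mul, ih, Nat.factorial_succ,
      show k + 1 + i + 1 = k + (i + 1) + 1 by ring]
    simp
    ring

theorem bernoulliPhi_two {k : ℕ} (hk : k ≠ 0) : bernoulliPhi k 2 = 1 := by
  have h := bernoulliPhi_add_one k 1
  rw [bernoulliPhi_one hk] at h
  norm_num at h
  exact h

/-- The recurrence `∑_{r ≤ k} C(k+1, r) B_r = 0` with the terms `r = 0, 1` split off. -/
theorem bernoulli_bracket_eq_one {k : ℕ} (hk : 1 ≤ k) :
    (1 / 2 + 1 / ((k : ℚ) + 1)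
      * (1 + ∑ r ∈ Finset.Icc 2 k, ((k + 1).choose r : ℚ) * bernoulli r)) = 1 := by
  have h := sum_bernoulli (k + 1)
  rw [if_neg (by omega), ← Finset.sum_range_add_sum_Ico _ (show 2 ≤ k + 1 by omega)] at h
  rw [← Finset.Ico_add_one_right_eq_Icc]
  simp only [Finset.sum_range_succ, Finset.sum_range_zero, bernoulli_zero, bernoulli_one,
    Nat.choose_zero_right, Nat.choose_one_right] at h
  push_cast at h
  have : (k : ℚ) + 1 ≠ 0 := by positivity
  field_simp
  linarith

theorem mul_integral_pow_mul_log_Gamma {k : ℕ} (hk : 1 ≤ k) :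
    (k : ℝ) * (∫ t in (0 : ℝ)..1, (1 - t) ^ (k - 1) * Real.log (Real.Gamma (t + 1)))
      = (∑ r ∈ Finset.range k, (k.choose r : ℝ) * gkbL r) - (harmonic k : ℝ) := by
  obtain ⟨j, rfl⟩ : ∃ j, k = j + 1 := ⟨k - 1, by omega⟩
  have h1 := integral_pow_mul_nestedLogGamma j 0
  -- At `w = 1` the sum is `log 1 = 0`, so the general solution becomes a linear relation for the
  -- nested integral at `1`.
  have h2 := (satisfiesBenderskyEquation (j + 1)).apply_natCast 1
  simp only [benderskyLogGamma, Nat.cast_one, gkbPsi, one_pow, mul_one, Finset.Icc_self,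
    Finset.sum_singleton, Real.log_one, mul_zero, one_add_one_eq_two,
    bernoulliPhi_two (Nat.succ_ne_zero j), Nat.factorial_succ] at h2
  rw [zero_add] at h1
  simp only [Nat.add_sub_cancel]
  change ∫ t in (0 : ℝ)..1, (1 - t) ^ j * Real.log (Real.Gamma (t + 1)) = _ at h1
  rw [h1]
  push_cast at h2 ⊢
  linarith

/-! ### The example `k = 2` with `log Γ(t)`. -/

theorem integral_one_sub_mul_log : ∫ t in (0 : ℝ)..1, (1 - t) * Real.log t = -(3 / 4) := by
  have h1 : ∫ t in (0 : ℝ)..1, t * Real.log t = -(1 / 4) := by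
    have h := intervalIntegral.integral_eq_sub_of_hasDerivAt_of_le (a := (0 : ℝ)) (b := 1)
      -- The primitive is written through `t * log t`, which is continuous at `0`, where
      -- differentiability is not required.
      zero_le_one (f := fun t => t / 2 * (t * Real.log t) - t ^ 2 / 4)
      (f' := fun t => t * Real.log t) ?_ ?_ ?_
    · rw [h]; norm_num
    · exact (((continuous_id.div_const 2).mul Real.continuous_mul_log).sub
        ((continuous_pow 2).div_const 4)).continuousOn
    · intro t ht
      have h := (((hasDerivAt_id t).div_const 2).mul ((hasDerivAt_id t).mul
        (Real.hasDerivAt_log ht.1.ne'))).sub ((hasDerivAt_pow 2 t).div_const 4)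
      convert! h using 1
      have := ht.1.ne'
      simp
      field_simp
      ring
    · exact Real.continuous_mul_log.intervalIntegrable _ _
  have h2 : ∀ t : ℝ, (1 - t) * Real.log t = Real.log t - t * Real.log t := fun t => by ring
  simp only [h2]
  rw [intervalIntegral.integral_sub intervalIntegral.intervalIntegrable_log'
    (Real.continuous_mul_log.intervalIntegrable _ _), h1, integral_log]
  norm_num

/-- `log Γ(t) = log Γ(t+1) - log t` isolates the singularity at `0` in an integrable logarithm. -/
theorem one_sub_mul_log_Gamma_eqOn : Set.EqOn
    (fun t : ℝ => (1 - t) ^ 1 * nestedLogGamma 0 t - (1 - t) * Real.log t)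
    (fun t : ℝ => (1 - t) * Real.log (Real.Gamma t)) (Set.uIoc 0 1) := by
  intro t ht
  rw [Set.uIoc_of_le zero_le_one] at ht
  have h := log_Gamma_add_two (x := t - 1) (by linarith [ht.1])
  rw [sub_add_cancel] at h
  simp only [nestedLogGamma, h]
  ring

theorem intervalIntegrable_one_sub_mul_log :
    IntervalIntegrable (fun t : ℝ => (1 - t) * Real.log t) MeasureTheory.volume 0 1 :=
  intervalIntegral.intervalIntegrable_log'.continuousOn_mul (by fun_prop)

theorem intervalIntegrable_one_sub_mul_log_Gamma :
    IntervalIntegrable (fun t : ℝ => (1 - t) * Real.log (Real.Gamma t))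
      MeasureTheory.volume 0 1 :=
  ((intervalIntegrable_pow_mul_nestedLogGamma 1 0).sub
    intervalIntegrable_one_sub_mul_log).congr one_sub_mul_log_Gamma_eqOn

theorem two_mul_integral_one_sub_mul_log_Gamma :
    2 * (∫ t in (0 : ℝ)..1, (1 - t) * Real.log (Real.Gamma t)) = gkbL 0 + 2 * gkbL 1 := by
  rw [← intervalIntegral.integral_congr_ae
    (Filter.Eventually.of_forall fun t ht => one_sub_mul_log_Gamma_eqOn ht),
    intervalIntegral.integral_sub (intervalIntegrable_pow_mul_nestedLogGamma 1 0)
    intervalIntegrable_one_sub_mul_log, integral_one_sub_mul_log]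
  -- The `-H_2 = -3/2` here cancels the `3/2` coming from the logarithmic integral.
  have h := mul_integral_pow_mul_log_Gamma (k := 2) (by norm_num)
  have h2 : (harmonic 2 : ℚ) = 3 / 2 := by norm_num [harmonic, Finset.sum_range_succ]
  simp only [h2, Finset.sum_range_succ, Finset.sum_range_zero] at h
  norm_num at h
  simp only [pow_one, nestedLogGamma]
  linarith

/-! ### Assembly. -/

theorem mainTheorem3 :
    -- the constants `L_k` exist and are unique
    (∀ (k : ℕ) (c : ℝ), IsGKBConstant k c ↔ c = gkbL k) ∧
    -- the general solution reproduces `log Γ_k(w + 1) = ∑_{m=1}^w m ^ k * log m`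
    (∀ k w : ℕ, benderskyLogGamma k (w : ℝ)
      = ∑ m ∈ Finset.Icc 1 w, (m : ℝ) ^ k * Real.log (m : ℝ)) ∧
    -- Adamchik's formula
    (∀ k : ℕ, deriv riemannZeta (-(k : ℂ))
      = (harmonic k : ℂ) * (bernoulli (k + 1) : ℂ) / ((k : ℂ) + 1) - (gkbL k : ℂ)) ∧
    -- the integral formula at `x = 1`, in its three forms
    (∀ k : ℕ, 1 ≤ k →
      IntervalIntegrable (fun t : ℝ => (1 - t) ^ (k - 1) * Real.log (Real.Gamma (t + 1)))
        MeasureTheory.volume 0 1 ∧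
      (k : ℝ) * (∫ t in (0 : ℝ)..1, (1 - t) ^ (k - 1) * Real.log (Real.Gamma (t + 1)))
        = (∑ r ∈ Finset.range k, (k.choose r : ℝ) * gkbL r)
          - (harmonic k : ℝ) * bernoulliPhi k 2 ∧
      (k : ℝ) * (∫ t in (0 : ℝ)..1, (1 - t) ^ (k - 1) * Real.log (Real.Gamma (t + 1)))
        = (∑ r ∈ Finset.range k, (k.choose r : ℝ) * gkbL r)
          - (harmonic k : ℝ) * (1 / 2 + 1 / ((k : ℝ) + 1)
              * (1 + ∑ r ∈ Finset.Icc 2 k, ((k + 1).choose r : ℝ) * (bernoulli r : ℝ))) ∧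
      (((k : ℝ) * (∫ t in (0 : ℝ)..1,
          (1 - t) ^ (k - 1) * Real.log (Real.Gamma (t + 1))) : ℝ) : ℂ)
        = (∑ r ∈ Finset.range k, (k.choose r : ℂ)
            * ((harmonic r : ℂ) * (bernoulli (r + 1) : ℂ) / ((r : ℂ) + 1)
              - deriv riemannZeta (-(r : ℂ))))
          - (harmonic k : ℂ) * (1 / 2 + 1 / ((k : ℂ) + 1)
              * (1 + ∑ r ∈ Finset.Icc 2 k, ((k + 1).choose r : ℂ) * (bernoulli r : ℂ)))) ∧
    -- the example `k = 2`, rewritten with `log Γ(t)`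
    IntervalIntegrable (fun t : ℝ => (1 - t) * Real.log (Real.Gamma t))
      MeasureTheory.volume 0 1 ∧
    ((2 * (∫ t in (0 : ℝ)..1, (1 - t) * Real.log (Real.Gamma t)) : ℝ) : ℂ)
      = -deriv riemannZeta 0 - 2 * deriv riemannZeta (-1) + 1 / 6 := by
  have hbr : ∀ k : ℕ, 1 ≤ k → (1 / 2 + 1 / ((k : ℝ) + 1)
      * (1 + ∑ r ∈ Finset.Icc 2 k, ((k + 1).choose r : ℝ) * (bernoulli r : ℝ))) = 1 :=
    fun k hk => by
      have h := congrArg (fun q : ℚ => (q : ℝ)) (bernoulli_bracket_eq_one hk)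
      push_cast at h
      exact h
  have hbrC : ∀ k : ℕ, 1 ≤ k → (1 / 2 + 1 / ((k : ℂ) + 1)
      * (1 + ∑ r ∈ Finset.Icc 2 k, ((k + 1).choose r : ℂ) * (bernoulli r : ℂ))) = 1 :=
    fun k hk => by
      have h := congrArg (fun q : ℚ => (q : ℂ)) (bernoulli_bracket_eq_one hk)
      push_cast at h
      exact h
  refine ⟨isGKBConstant_iff, fun k w => (satisfiesBenderskyEquation k).apply_natCast w,
    deriv_riemannZeta_neg_natCast, fun k hk => ⟨?_, ?_, ?_, ?_⟩,
    intervalIntegrable_one_sub_mul_log_Gamma, ?_⟩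
  · exact intervalIntegrable_pow_mul_nestedLogGamma (k - 1) 0
  · rw [mul_integral_pow_mul_log_Gamma hk, bernoulliPhi_two (by omega), mul_one]
  · rw [mul_integral_pow_mul_log_Gamma hk, hbr k hk, mul_one]
  · rw [mul_integral_pow_mul_log_Gamma hk, hbrC k hk, mul_one]
    simp only [deriv_riemannZeta_neg_natCast, sub_sub_cancel]
    push_cast
    rfl
  -- The `1/6` is `2 · H_1 B_2 / 2`; for `L_0` the Bernoulli term is absent because `H_0 = 0`.
  · rw [two_mul_integral_one_sub_mul_log_Gamma]
    have h0 := deriv_riemannZeta_neg_natCast 0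
    have h1 := deriv_riemannZeta_neg_natCast 1
    norm_num [bernoulli_two] at h0 h1
    rw [h0, h1]
    push_cast
    ring
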